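/- Let $\mathbb K$ be a field of characteristic $p>2$. A Lie superalgebra over $\mathbb K$ is a $\mathbb Z/2$-graded space $\mathfrak a=\mathfrak a_{\bar 0}\oplus\mathfrak a_{\bar 1}$ with an even bilinear bracket satisfying super-antisymmetry, the super Jacobi identity and $[a,[a,a]]=0$ for all $a\in\mathfrak a_{\bar 1}$. For $a,b\in\mathfrak a_{\bar 0}$ define $s_i(a,b)$ by $(\mathrm{ad}_{\lambda a+b})^{p-1}(a)=\sum_{i=1}^{p-1} i\,s_i(a,b)\lambda^{i-1}$, where $\lambda$ is an indeterminate. A $p|2p$-structure on $\mathfrak a$ is a map $a\mapsto a^{[p]}$, $\mathfrak a_{\bar 0}\to\mathfrak a_{\bar 0}$, with $\mathrm{ad}_{a^{[p]}}=(\mathrm{ad}_a)^p$ on all of $\mathfrak a$, $(\alpha a)^{[p]}=\alpha^pa^{[p]}$ and $(a+b)^{[p]}=a^{[p]}+b^{[p]}+\sum_{i=1}^{p-1}s_i(a,b)$, together with the map $\mathfrak a_{\bar 1}\to\mathfrak a_{\bar 0}$, $a\mapsto a^{[2p]}=(\tfrac12[a,a])^{[p]}$. Let $\mathfrak a$ be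 a Lie superalgebra with a $p|2p$-structure $[p]_{\mathfrak a}$ and with an even non-degenerate invariant supersymmetric bilinear form (an even NIS) $\mathscr B$. Let $\mathscr D$ be a homogeneous derivation of $\mathfrak a$, of parity $p(\mathscr D)$, which is restricted, i.e. $\mathscr D(a^{[p]_{\mathfrak a}})=(\mathrm{ad}_a)^{p-1}(\mathscr D(a))$ for $a\in\mathfrak a_{\bar 0}$, and such that $\mathscr B(\mathscr D(a),b)+(-1)^{p(\mathscr D)p(a)}\mathscr B(a,\mathscr D(b))=0$ for all $b\in\mathfrak a$ and all homogeneous $a\in\mathfrak a$. Put $\mathfrak g=\mathbb Kx\oplus\mathfrak a\oplus\mathbb Kx^*$ with $p(x)=p(x^*)=p(\mathscr D)$, and let $\mathscr B_{\mathfrak g}$ be the supersymmetric form on $\mathfrak g$ that extends $\mathscr B$ and satisfies $\mathscr B_{\mathfrak g}(x,x^*)=1$, $\mathscr B_{\mathfrak g}(\mathfrak a,x)=\mathscr B_{\mathfrak g}(\mathfrak a,x^*)=\mathscr B_{\mathfrak g}(x,x)=\mathscr B_{\mathfrak g}(x^*,x^*)=0$. (i) Suppose that $\mathscr D$ is odd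 and that $b_0\in\mathfrak a_{\bar 0}$ satisfies $\mathscr D(b_0)=0$, $\mathscr D^2=\mathrm{ad}_{b_0}$, $\mathscr B(b_0,b_0)=0$. If $p=3$, suppose moreover that $\mathscr B(\mathscr D(a),[a,a])=0$ for all $a\in\mathfrak a_{\bar 1}$. Suppose finally that $$2\mathscr B(a^{[p]_{\mathfrak a}},b_0)-\mathscr B\bigl(\mathscr D(a),(\mathrm{ad}_a)^{p-2}(\mathscr D(a))\bigr)=0\quad\text{for all }a\in\mathfrak a_{\bar 0}.$$ Then $\mathfrak g$, with the super-antisymmetric bracket given by $[x,\mathfrak g]_{\mathfrak g}=0$, $[a,b]_{\mathfrak g}=[a,b]-\mathscr B(\mathscr D(a),b)x$, $[x^*,a]_{\mathfrak g}=\mathscr D(a)-2\mathscr B(a,b_0)x$ and $[x^*,x^*]_{\mathfrak g}=2b_0$ for $a,b\in\mathfrak a$, is a Lie superalgebra with even NIS $\mathscr B_{\mathfrak g}$, and it has exactly one $p|2p$-structure with $a^{[p]_{\mathfrak g}}=a^{[p]_{\mathfrak a}}$ for all $a\in\mathfrak a_{\bar 0}$. (ii) Suppose that $\mathscr D$ is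 even and has the $p$-property, with $\gamma\in\mathbb K$ and $a_0\in\mathfrak a_{\bar 0}$ such that $\mathscr D^p=\gamma\mathscr D+\mathrm{ad}_{a_0}$ and $\mathscr D(a_0)=0$. Let $m,l\in\mathbb K$ be arbitrary, let $c_0\in\mathfrak a_{\bar 0}$ be central in $\mathfrak a$ with $\mathscr D(c_0)=0$, and let $\mathscr P:\mathfrak a_{\bar 0}\to\mathbb K$ be any map with $$\mathscr P(\lambda a)=\lambda^p\mathscr P(a),\qquad \mathscr P(a+b)-\mathscr P(a)-\mathscr P(b)=\sum_{i=1}^{p-1}\sigma_i(a,b)\qquad(a,b\in\mathfrak a_{\bar 0},\ \lambda\in\mathbb K),$$ where the $\sigma_i(a,b)\in\mathbb K$ are defined by $\mathscr B\bigl(\mathscr D(\lambda a+b),(\mathrm{ad}_{\lambda a+b})^{p-2}(a)\bigr)=\sum_{i=1}^{p-1}i\,\sigma_i(a,b)\lambda^{i-1}$. Then $\mathfrak g$, with the super-antisymmetric bracket given by $[x,\mathfrak g]_{\mathfrak g}=0$, $[a,b]_{\mathfrak g}=[a,b]+\mathscr B(\mathscr D(a),b)x$, $[x^*,a]_{\mathfrak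 g}=\mathscr D(a)$ and $[x^*,x^*]_{\mathfrak g}=0$ for $a,b\in\mathfrak a$, is a Lie superalgebra with even NIS $\mathscr B_{\mathfrak g}$, and it has exactly one $p|2p$-structure such that $$a^{[p]_{\mathfrak g}}=a^{[p]_{\mathfrak a}}+\mathscr P(a)x\ \ (a\in\mathfrak a_{\bar 0}),\qquad (x^*)^{[p]_{\mathfrak g}}=a_0+lx+\gamma x^*,\qquad x^{[p]_{\mathfrak g}}=mx+c_0.$$ -/

import Mathlib

namespace SuperDE

noncomputable section

variable {K : Type*} [Field K] {A : Type*} [AddCommGroup A] [Module K A]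

/-- `br` is a Lie superalgebra bracket on the `ℤ/2`-graded space `A = gr 0 ⊕ gr 1` over a field of
characteristic different from `2`. The last axiom follows from the Jacobi identity unless the
characteristic is `3`, where it is part of the definition. -/
structure IsLieSuperalgebra (gr : ZMod 2 → Submodule K A) (br : A →ₗ[K] A →ₗ[K] A) : Prop where
  isInternal : DirectSum.IsInternal gr
  bracket_mem : ∀ (i j : ZMod 2) (a b : A), a ∈ gr i → b ∈ gr j → br a b ∈ gr (i + j)
  skew : ∀ (i j : ZMod 2) (a b : A), a ∈ gr i → b ∈ gr j →
    br a b = -((-1 : K) ^ (i.val * j.val) • br b a)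
  jacobi : ∀ (i j k : ZMod 2) (a b c : A), a ∈ gr i → b ∈ gr j → c ∈ gr k →
    br a (br b c) = br (br a b) c + (-1 : K) ^ (i.val * j.val) • br b (br a c)
  odd_triple : ∀ a ∈ gr 1, br a (br a a) = 0

/-- `B` is an even NIS: an even, non-degenerate, invariant, (super)symmetric bilinear form. -/
structure IsEvenNIS (gr : ZMod 2 → Submodule K A) (br : A →ₗ[K] A →ₗ[K] A)
    (B : A →ₗ[K] A →ₗ[K] K) : Prop where
  even : ∀ (i j : ZMod 2) (a b : A), a ∈ gr i → b ∈ gr j → i ≠ j → B a b = 0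
  symm : ∀ (i j : ZMod 2) (a b : A), a ∈ gr i → b ∈ gr j →
    B b a = (-1 : K) ^ (i.val * j.val) * B a b
  invariant : ∀ a b c : A, B (br a b) c = B a (br b c)
  nondegenerate : B.Nondegenerate

/-- `D` is a derivation of parity `d`. -/
structure IsSuperDerivation (gr : ZMod 2 → Submodule K A) (br : A →ₗ[K] A →ₗ[K] A)
    (d : ZMod 2) (D : Module.End K A) : Prop where
  map_mem : ∀ (i : ZMod 2) (a : A), a ∈ gr i → D a ∈ gr (i + d)
  leibniz : ∀ (i : ZMod 2) (a b : A), a ∈ gr i →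
    D (br a b) = br (D a) b + (-1 : K) ^ (d.val * i.val) • br a (D b)

/-- The form `B` is `D`-invariant, where `D` has parity `d`. -/
def IsDInvariant (gr : ZMod 2 → Submodule K A) (B : A →ₗ[K] A →ₗ[K] K)
    (d : ZMod 2) (D : Module.End K A) : Prop :=
  ∀ (i : ZMod 2) (a b : A), a ∈ gr i → B (D a) b + (-1 : K) ^ (d.val * i.val) * B a (D b) = 0

/-- The operator `ad_{λ a + b}`, as a polynomial in the indeterminate `λ` with coefficients
in `End A`. -/
def adLam (br : A →ₗ[K] A →ₗ[K] A) (a b : A) : Polynomial (Module.End K A) :=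
  Polynomial.X * Polynomial.C (br a : Module.End K A) + Polynomial.C (br b : Module.End K A)

/-- The elements `s_i(a,b)`, given for `1 ≤ i ≤ p - 1` by
`(ad_{λ a + b})^{p-1}(a) = ∑ i s_i(a,b) λ^{i-1}`. -/
def sCoeff (p : ℕ) (br : A →ₗ[K] A →ₗ[K] A) (a b : A) (i : ℕ) : A :=
  (i : K)⁻¹ • ((adLam br a b ^ (p - 1)).coeff (i - 1)) a

/-- The polynomial `B(D(λ a + b), (ad_{λ a + b})^{p-2}(a))` in the indeterminate `λ`. -/
def sigmaPoly (p : ℕ) (br : A →ₗ[K] A →ₗ[K] A) (B : A →ₗ[K] A →ₗ[K] K) (D : Module.End K A)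
    (a b : A) : Polynomial K :=
  ∑ j ∈ Finset.range (p - 1),
    (Polynomial.C (B (D a) ((adLam br a b ^ (p - 2)).coeff j a)) * Polynomial.X
      + Polynomial.C (B (D b) ((adLam br a b ^ (p - 2)).coeff j a))) * Polynomial.X ^ j

/-- The scalars `σ_i(a,b)`, given for `1 ≤ i ≤ p - 1` by
`B(D(λ a + b), (ad_{λ a + b})^{p-2}(a)) = ∑ i σ_i(a,b) λ^{i-1}`. -/
def sigmaCoeff (p : ℕ) (br : A →ₗ[K] A →ₗ[K] A) (B : A →ₗ[K] A →ₗ[K] K) (D : Module.End K A)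
    (a b : A) (i : ℕ) : K :=
  (i : K)⁻¹ * (sigmaPoly p br B D a b).coeff (i - 1)

/-- A `p|2p`-structure: a `p`-structure `[p]` on the even part such that `ad_{a^[p]} = (ad_a)^p`
on the whole superalgebra, together with the map `[2p]` on the odd part, `a ↦ (a²)^[p]`, where
`a²` is the even element with `2 a² = [a,a]`. -/
structure P2pStructure (p : ℕ) (gr : ZMod 2 → Submodule K A) (br : A →ₗ[K] A →ₗ[K] A) where
  pMap : gr 0 → gr 0
  twoPMap : gr 1 → gr 0
  ad_pMap : ∀ a : gr 0, (br (pMap a : A) : Module.End K A) = (br (a : A) : Module.End K A) ^ p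
  pMap_smul : ∀ (c : K) (a : gr 0), pMap (c • a) = c ^ p • pMap a
  pMap_add : ∀ a b : gr 0, (pMap (a + b) : A) =
    pMap a + pMap b + ∑ i ∈ Finset.Icc 1 (p - 1), sCoeff p br (a : A) (b : A) i
  twoPMap_eq : ∀ (a : gr 1) (s : gr 0), (2 : K) • (s : A) = br (a : A) (a : A) →
    twoPMap a = pMap s

/-- `D` is restricted with respect to a `p|2p`-structure. -/
def IsRestrictedDer {p : ℕ} {gr : ZMod 2 → Submodule K A} {br : A →ₗ[K] A →ₗ[K] A}
    (S : P2pStructure p gr br) (D : Module.End K A) : Prop :=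
  ∀ a : gr 0, D (S.pMap a : A) = ((br (a : A) : Module.End K A) ^ (p - 1)) (D (a : A))

/-- The space `𝔤 = K x ⊕ 𝔞 ⊕ K x*`; the triple `(u, a, v)` stands for `u x + a + v x*`. -/
abbrev DExt (K : Type*) (A : Type*) : Type _ := K × A × K

/-- The grading of `𝔤` for which `x` and `x*` have parity `d`. -/
def extGr (d : ZMod 2) (gr : ZMod 2 → Submodule K A) (i : ZMod 2) : Submodule K (DExt K A) :=
  (if i = d then ⊤ else ⊥ : Submodule K K).prod
    ((gr i).prod (if i = d then ⊤ else ⊥ : Submodule K K))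

/-- An even element of `𝔞` as an even element of `𝔤`. -/
def inclEven (d : ZMod 2) (gr : ZMod 2 → Submodule K A) (a : gr 0) : extGr d gr 0 :=
  ⟨(0, (a : A), 0), by simp [extGr]⟩

/-- The element `x` of `𝔤`, even when `d = 0`. -/
def xEven (gr : ZMod 2 → Submodule K A) : extGr 0 gr 0 :=
  ⟨(1, 0, 0), by simp [extGr]⟩

/-- The element `x*` of `𝔤`, even when `d = 0`. -/
def xStarEven (gr : ZMod 2 → Submodule K A) : extGr 0 gr 0 :=
  ⟨(0, 0, 1), by simp [extGr]⟩

/-- The parity involution `a ↦ (-1)^{p(a)} a`. -/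
def parityInv (gr : ZMod 2 → Submodule K A) [DirectSum.Decomposition gr] :
    Module.End K A where
  toFun a := (DirectSum.decompose gr a 0 : A) - (DirectSum.decompose gr a 1 : A)
  map_add' a b := by
    simp only [DirectSum.decompose_add, DirectSum.add_apply, Submodule.coe_add]
    abel
  map_smul' c a := by
    simp only [DirectSum.decompose_smul, DirectSum.smul_apply, Submodule.coe_smul,
      RingHom.id_apply, smul_sub]

/-- The bracket of the double extension by an even derivation: `x` is central and
`[a,b]_𝔤 = [a,b] + B(D a, b) x`, `[x*,a]_𝔤 = D a = -[a,x*]_𝔤`, `[x*,x*]_𝔤 = 0`. -/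
def evenExtBr (br : A →ₗ[K] A →ₗ[K] A) (B : A →ₗ[K] A →ₗ[K] K) (D : Module.End K A) :
    DExt K A →ₗ[K] DExt K A →ₗ[K] DExt K A :=
  LinearMap.mk₂ K
    (fun f g => (B (D f.2.1) g.2.1, br f.2.1 g.2.1 + f.2.2 • D g.2.1 - g.2.2 • D f.2.1, 0))
    (by
      intro f f' g
      ext <;> simp
      module)
    (by
      intro c f g
      ext <;> simp
      module)
    (by
      intro f g g'
      ext <;> simp
      module)
    (by
      intro c f g
      ext <;> simp
      module)

set_option linter.unusedSimpArgs false in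
/-- The bracket of the double extension by an odd derivation: `x` is central and
`[a,b]_𝔤 = [a,b] - B(D a, b) x`, `[x*,a]_𝔤 = D a - 2 B(a,b₀) x = -(-1)^{p(a)} [a,x*]_𝔤`,
`[x*,x*]_𝔤 = 2 b₀`. (The scalar `B(a,b₀)` vanishes for odd `a`.) -/
def oddExtBr (gr : ZMod 2 → Submodule K A) [DirectSum.Decomposition gr]
    (br : A →ₗ[K] A →ₗ[K] A) (B : A →ₗ[K] A →ₗ[K] K) (D : Module.End K A) (b₀ : A) :
    DExt K A →ₗ[K] DExt K A →ₗ[K] DExt K A :=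
  LinearMap.mk₂ K
    (fun f g =>
      (-B (D f.2.1) g.2.1 - 2 * f.2.2 * B g.2.1 b₀ + 2 * g.2.2 * B f.2.1 b₀,
        br f.2.1 g.2.1 + f.2.2 • D g.2.1 - g.2.2 • D (parityInv gr f.2.1)
          + (2 * f.2.2 * g.2.2) • b₀,
        0))
    (by
      intro f f' g
      refine Prod.ext ?_ (Prod.ext ?_ ?_)
      · simp only [Prod.smul_fst, Prod.smul_snd, Prod.fst_add, Prod.snd_add, map_add, map_smul,
          LinearMap.add_apply, LinearMap.smul_apply, smul_eq_mul]
        ring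
      · simp only [Prod.smul_fst, Prod.smul_snd, Prod.fst_add, Prod.snd_add, map_add, map_smul,
          LinearMap.add_apply, LinearMap.smul_apply, smul_eq_mul]
        module
      · simp)
    (by
      intro c f g
      refine Prod.ext ?_ (Prod.ext ?_ ?_)
      · simp only [Prod.smul_fst, Prod.smul_snd, Prod.fst_add, Prod.snd_add, map_add, map_smul,
          LinearMap.add_apply, LinearMap.smul_apply, smul_eq_mul]
        ring
      · simp only [Prod.smul_fst, Prod.smul_snd, Prod.fst_add, Prod.snd_add, map_add, map_smul,
          LinearMap.add_apply, LinearMap.smul_apply, smul_eq_mul]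
        module
      · simp)
    (by
      intro f g g'
      refine Prod.ext ?_ (Prod.ext ?_ ?_)
      · simp only [Prod.smul_fst, Prod.smul_snd, Prod.fst_add, Prod.snd_add, map_add, map_smul,
          LinearMap.add_apply, LinearMap.smul_apply, smul_eq_mul]
        ring
      · simp only [Prod.smul_fst, Prod.smul_snd, Prod.fst_add, Prod.snd_add, map_add, map_smul,
          LinearMap.add_apply, LinearMap.smul_apply, smul_eq_mul]
        module
      · simp)
    (by
      intro c f g
      refine Prod.ext ?_ (Prod.ext ?_ ?_)
      · simp only [Prod.smul_fst, Prod.smul_snd, Prod.fst_add, Prod.snd_add, map_add, map_smul,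
          LinearMap.add_apply, LinearMap.smul_apply, smul_eq_mul]
        ring
      · simp only [Prod.smul_fst, Prod.smul_snd, Prod.fst_add, Prod.snd_add, map_add, map_smul,
          LinearMap.add_apply, LinearMap.smul_apply, smul_eq_mul]
        module
      · simp)

/-- The form on `𝔤`, where `x` and `x*` have parity `d`: it extends `B`, `B_𝔤(x,x*) = 1`,
`B_𝔤(x*,x) = (-1)^d`, and all other products of `x`, `x*` and elements of `𝔞` are zero. -/
def extForm (d : ZMod 2) (B : A →ₗ[K] A →ₗ[K] K) : DExt K A →ₗ[K] DExt K A →ₗ[K] K :=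
  LinearMap.mk₂ K
    (fun f g => B f.2.1 g.2.1 + f.1 * g.2.2 + (-1 : K) ^ d.val * (f.2.2 * g.1))
    (by intro f f' g; simp; ring)
    (by intro c f g; simp; ring)
    (by intro f g g'; simp; ring)
    (by intro c f g; simp; ring)

end

end SuperDE

/-! The brackets on `𝔤` are verified directly. A derivation `D` preserving `B` makes `B(D a, b)` a
2-cocycle, which accounts for the `x`-coordinate. Brackets with `x*` use the Leibniz rule and, for
odd `D`, the relations `D² = ad_{b₀}`, `D b₀ = 0` and `B(b₀,b₀) = 0`.

The substance is the `p|2p`-structure, which is determined by its `p`-map on the even part. The sum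
`∑ s_i(a,b)` is the formal integral of `(ad_{λa+b})^{p-1}(a)` over `0 ≤ λ ≤ 1`, that is, the
integral of the one-form `ω_Z(V) = (ad_Z)^{p-1}(V)` along the segment from `b` to `a + b`. Since
`(p-1).choose k ≡ (-1)^k` mod `p`, this form is closed (`sum_ad_pow_lie_comm`), so its integrals
along the two ways round a parallelogram agree. Hence `∑ s_i` is a symmetric 2-cocycle
(`sSum_lieBr_cocycle`). This is exactly what allows a `p`-map prescribed on the summands of `K x ⊕ H
⊕ K t`, with `x` central, to be glued (`SplitDecomp.exists_P2p`). The axiom on `ad` for the glued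
map follows from Jacobson's formula in `End` (`add_pow_char_eq_add_sSum`), because `ad` is a
representation of the even part.

For even `D` it remains to check the prescribed values on `𝔞_0`, `x` and `x*`; the condition on `P`
says that the `x`-coordinates of the `s_i` of `𝔤` are accounted for. For odd `D` the even part of
`𝔤` is `𝔞_0` with the same bracket, so the `p`-map is inherited and only its action on `x*` and on
odd elements is new. -/

namespace SuperDE

open Finset TensorProduct

/-! ### Binomial coefficients modulo `p` -/

section Binomial

/-- By Pascal's rule, consecutive entries of row `p - 1` add up to an entry of row `p`, which is
zero modulo `p`. -/
lemma choose_pred_eq_neg_one_pow {R : Type*} [Ring R] (p : ℕ) [hp : Fact p.Prime]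
    (hpR : (p : R) = 0) {k : ℕ} (hk : k < p) : ((p - 1).choose k : R) = (-1) ^ k := by
  induction k with
  | zero => simp
  | succ k ih =>
    have h := Nat.choose_succ_succ' (p - 1) k
    rw [Nat.sub_add_cancel hp.out.one_le] at h
    have h0 : ((p.choose (k + 1) : ℕ) : R) = 0 := by
      obtain ⟨m, hm⟩ := hp.out.dvd_choose_self (by omega) hk
      rw [hm, Nat.cast_mul, hpR, zero_mul]
    rw [h, Nat.cast_add, ih (by omega)] at h0
    rw [pow_succ, mul_neg_one]
    exact eq_neg_of_add_eq_zero_right h0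

lemma sub_pow_pred_of_commute {R : Type*} [Ring R] (p : ℕ) [hp : Fact p.Prime]
    (hpR : (p : R) = 0) (hodd : Odd p) {x y : R} (h : Commute x y) :
    (x - y) ^ (p - 1) = ∑ i ∈ range p, x ^ i * y ^ (p - 1 - i) := by
  rw [sub_eq_add_neg, (h.neg_right).add_pow, Nat.sub_add_cancel hp.out.one_le]
  refine sum_congr rfl fun i hi => ?_
  have hi' := mem_range.1 hi
  rw [choose_pred_eq_neg_one_pow p hpR hi', neg_pow y, mul_assoc, mul_assoc]
  congr 1
  -- The signs combine to `(-1)^(p-1) = 1`, because `p` is odd.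
  rw [((Commute.neg_one_right _).pow_right i).eq, ← mul_assoc, ← pow_add,
    show p - 1 - i + i = p - 1 by omega, (hodd.tsub_odd odd_one).neg_one_pow, one_mul]

end Binomial

/-! ### Closedness of the one-form `Z ↦ (ad_Z)^{p-1}` -/

section Closedness

variable {R L : Type*} [CommRing R] [LieRing L] [LieAlgebra R L] (p : ℕ) [hp : Fact p.Prime]
  [CharP R p]

/-- The left side is the derivative of `(ad_Z)^{p-1} W` in the direction `V`. Expand by the Leibniz
rule; by the hockey-stick identity the coefficient of the `j`-th term is `(p-1).choose (j+1) ≡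
(-1)^(j+1)`. -/
lemma sum_ad_pow_lie_ad_pow (Z V W : L) :
    ∑ a ∈ range (p - 1), (LieAlgebra.ad R L Z ^ a) ⁅V, (LieAlgebra.ad R L Z ^ (p - 2 - a)) W⁆ =
      ∑ j ∈ range (p - 1), (-1 : R) ^ (j + 1) •
        ⁅(LieAlgebra.ad R L Z ^ j) V, (LieAlgebra.ad R L Z ^ (p - 2 - j)) W⁆ := by
  have hp2 := hp.out.two_le
  have h1 : ∀ a ∈ range (p - 1),
      (LieAlgebra.ad R L Z ^ a) ⁅V, (LieAlgebra.ad R L Z ^ (p - 2 - a)) W⁆ =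
        ∑ j ∈ range (a + 1), a.choose j •
          ⁅(LieAlgebra.ad R L Z ^ j) V, (LieAlgebra.ad R L Z ^ (p - 2 - j)) W⁆ := by
    intro a ha
    rw [LieAlgebra.ad_pow_lie, Nat.sum_antidiagonal_eq_sum_range_succ_mk]
    refine sum_congr rfl fun j hj => ?_
    rw [← Module.End.mul_apply, ← pow_add]
    have := mem_range.1 ha
    have := mem_range.1 hj
    rw [show a - j + (p - 2 - a) = p - 2 - j by omega]
  rw [sum_congr rfl h1, sum_comm' (t' := range (p - 1)) (s' := fun j => Icc j (p - 2))]
  · refine sum_congr rfl fun j hj => ?_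
    have := mem_range.1 hj
    rw [← sum_smul, Nat.sum_Icc_choose, show p - 2 + 1 = p - 1 by omega, ← Nat.cast_smul_eq_nsmul R,
      choose_pred_eq_neg_one_pow p (CharP.cast_eq_zero R p) (by omega)]
  · intro a j
    simp only [mem_range, mem_Icc]
    omega

/-- The one-form `Z ↦ (ad_Z)^{p-1}` on a Lie algebra of odd characteristic `p` is closed. -/
lemma sum_ad_pow_lie_comm (hodd : Odd p) (Z V W : L) :
    ∑ a ∈ range (p - 1), (LieAlgebra.ad R L Z ^ a) ⁅V, (LieAlgebra.ad R L Z ^ (p - 2 - a)) W⁆ =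
      ∑ a ∈ range (p - 1),
        (LieAlgebra.ad R L Z ^ a) ⁅W, (LieAlgebra.ad R L Z ^ (p - 2 - a)) V⁆ := by
  have hp2 := hp.out.two_le
  -- The reflection `j ↦ p - 2 - j` exchanges the roles of `V` and `W`. The sign from skew-symmetry
  -- cancels the one from `p - 2` being odd.
  rw [sum_ad_pow_lie_ad_pow, sum_ad_pow_lie_ad_pow, ← sum_range_reflect]
  refine sum_congr rfl fun j hj => ?_
  have := mem_range.1 hj
  obtain ⟨k, rfl⟩ := hodd
  rw [show 2 * k + 1 - 1 - 1 - j = 2 * k + 1 - 2 - j by omega,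
    show 2 * k + 1 - 2 - (2 * k + 1 - 2 - j) = j by omega, ← lie_skew, smul_neg, ← neg_smul]
  congr 1
  rcases Nat.even_or_odd j with h | h
  · rw [h.add_one.neg_one_pow, Even.neg_one_pow]
    grind
  · rw [h.add_one.neg_one_pow, Odd.neg_one_pow, neg_neg]
    grind

end Closedness

/-! ### Coefficients of powers of `ad_{λa+b}` -/

section Coefficients

variable {K : Type*} [Field K] {A : Type*} [AddCommGroup A] [Module K A]

lemma coeff_adLam_pow_succ_zero (br : A →ₗ[K] A →ₗ[K] A) (a b c : A) (n : ℕ) :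
    ((adLam br a b ^ (n + 1)).coeff 0) c = br b (((adLam br a b ^ n).coeff 0) c) := by
  rw [pow_succ', adLam, add_mul, Polynomial.coeff_add, mul_assoc]
  simp

lemma coeff_adLam_pow_succ_succ (br : A →ₗ[K] A →ₗ[K] A) (a b c : A) (n i : ℕ) :
    ((adLam br a b ^ (n + 1)).coeff (i + 1)) c =
      br a (((adLam br a b ^ n).coeff i) c) + br b (((adLam br a b ^ n).coeff (i + 1)) c) := by
  rw [pow_succ', adLam, add_mul, Polynomial.coeff_add, mul_assoc]
  simp

lemma coeff_adLam_pow_zero (br : A →ₗ[K] A →ₗ[K] A) (a b c : A) (i : ℕ) :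
    ((adLam br a b ^ 0).coeff i) c = if i = 0 then c else 0 := by
  rw [pow_zero, Polynomial.coeff_one]
  split_ifs <;> simp

/-- The sum `∑ s_i(a,b)` over `1 ≤ i ≤ p - 1`. -/
noncomputable def sSum (p : ℕ) (br : A →ₗ[K] A →ₗ[K] A) (a b : A) : A :=
  ∑ i ∈ Icc 1 (p - 1), sCoeff p br a b i

/-- This is the form as an integral: `λ^i` integrates to `1/(i+1)`. The coefficient of `λ^{p-1}`,
which has no primitive in characteristic `p`, is left out. -/
lemma sSum_eq_sum_range (p : ℕ) (br : A →ₗ[K] A →ₗ[K] A) (a b : A) :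
    sSum p br a b =
      ∑ i ∈ range (p - 1), ((i + 1 : ℕ) : K)⁻¹ • ((adLam br a b ^ (p - 1)).coeff i) a := by
  refine sum_nbij' (· - 1) (· + 1) ?_ ?_ ?_ ?_ ?_
  · intro i hi; have := mem_Icc.1 hi; exact mem_range.2 (by omega)
  · intro i hi; have := mem_range.1 hi; exact mem_Icc.2 (by omega)
  · intro i hi; have := mem_Icc.1 hi; omega
  · intro i _; rfl
  · intro i hi
    have := mem_Icc.1 hi
    rw [sCoeff, Nat.sub_add_cancel this.1]

end Coefficients

/-! ### The cocycle identity, by integrating over the parallelogram `σ z + τ x + y` -/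

section Bivariate

variable {K L : Type*} [Field K] [LieRing L] [LieAlgebra K L]

/-- The bracket of a Lie algebra as a bilinear map. -/
def lieBr (K L : Type*) [Field K] [LieRing L] [LieAlgebra K L] : L →ₗ[K] L →ₗ[K] L :=
  (LieAlgebra.ad K L : L →ₗ[K] Module.End K L)

@[simp] lemma lieBr_apply (a b : L) : lieBr K L a b = ⁅a, b⁆ := rfl

/-- The element `σ z + τ x + y` of `K[σ,τ] ⊗ L`. -/
noncomputable def biElt (K : Type*) {L : Type*} [Field K] [LieRing L] [LieAlgebra K L]
    (x y z : L) : MvPolynomial (Fin 2) K ⊗[K] L :=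
  MvPolynomial.X 0 ⊗ₜ z + MvPolynomial.X 1 ⊗ₜ x + 1 ⊗ₜ y

/-- The coefficient of `σ^i τ^j` of an element of `K[σ,τ] ⊗ L`. -/
noncomputable def biCoeff (K L : Type*) [Field K] [LieRing L] [LieAlgebra K L] (i j : ℕ) :
    MvPolynomial (Fin 2) K ⊗[K] L →ₗ[K] L :=
  (TensorProduct.lid K L).toLinearMap ∘ₗ
    (MvPolynomial.lcoeff K (Finsupp.single 0 i + Finsupp.single 1 j)).rTensor L

/-- The partial derivative on `K[σ,τ] ⊗ L`. -/
noncomputable def biDeriv (K L : Type*) [Field K] [LieRing L] [LieAlgebra K L] (s : Fin 2) :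
    MvPolynomial (Fin 2) K ⊗[K] L →ₗ[K] MvPolynomial (Fin 2) K ⊗[K] L :=
  (MvPolynomial.pderiv s).toLinearMap.rTensor L

lemma biCoeff_tmul (i j : ℕ) (f : MvPolynomial (Fin 2) K) (l : L) :
    biCoeff K L i j (f ⊗ₜ l) = f.coeff (Finsupp.single 0 i + Finsupp.single 1 j) • l := by
  simp [biCoeff, MvPolynomial.lcoeff]

/-- The adjoint action of `K[σ,τ] ⊗ L` on itself. -/
noncomputable def extAd (K L : Type*) [Field K] [LieRing L] [LieAlgebra K L] :
    MvPolynomial (Fin 2) K ⊗[K] L →ₗ[MvPolynomial (Fin 2) K]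
      Module.End (MvPolynomial (Fin 2) K) (MvPolynomial (Fin 2) K ⊗[K] L) :=
  (LieAlgebra.ad (MvPolynomial (Fin 2) K) (MvPolynomial (Fin 2) K ⊗[K] L) :)

lemma extAd_tmul (f g : MvPolynomial (Fin 2) K) (l m : L) :
    extAd K L (f ⊗ₜ l) (g ⊗ₜ m) = (f * g) ⊗ₜ ⁅l, m⁆ := rfl

lemma biCoeff_extAd_one (i j : ℕ) (y : L) (q : MvPolynomial (Fin 2) K ⊗[K] L) :
    biCoeff K L i j (extAd K L (1 ⊗ₜ y) q) = ⁅y, biCoeff K L i j q⁆ := by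
  induction q with
  | zero => simp
  | add a b ha hb => simp [ha, hb]
  | tmul f l => simp [biCoeff_tmul, extAd_tmul]

lemma biCoeff_extAd_X_zero (i j : ℕ) (z : L) (q : MvPolynomial (Fin 2) K ⊗[K] L) :
    biCoeff K L i j (extAd K L (MvPolynomial.X 0 ⊗ₜ z) q) =
      if i = 0 then 0 else ⁅z, biCoeff K L (i - 1) j q⁆ := by
  induction q with
  | zero => simp
  | add a b ha hb => rw [map_add, map_add, ha, hb, map_add, lie_add]; split_ifs <;> simp
  | tmul f l =>
    rw [extAd_tmul, biCoeff_tmul, biCoeff_tmul, MvPolynomial.coeff_X_mul']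
    rcases i with _ | i
    · simp
    · have : (Finsupp.single (0 : Fin 2) (i + 1) + Finsupp.single 1 j - Finsupp.single 0 1) =
          Finsupp.single 0 i + Finsupp.single 1 j := by
        ext k; fin_cases k <;> simp
      rw [this, if_pos (by simp), if_neg (by omega), lie_smul, Nat.add_sub_cancel]

lemma biCoeff_extAd_X_one (i j : ℕ) (x : L) (q : MvPolynomial (Fin 2) K ⊗[K] L) :
    biCoeff K L i j (extAd K L (MvPolynomial.X 1 ⊗ₜ x) q) =
      if j = 0 then 0 else ⁅x, biCoeff K L i (j - 1) q⁆ := by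
  induction q with
  | zero => simp
  | add a b ha hb => rw [map_add, map_add, ha, hb, map_add, lie_add]; split_ifs <;> simp
  | tmul f l =>
    rw [extAd_tmul, biCoeff_tmul, biCoeff_tmul, MvPolynomial.coeff_X_mul']
    rcases j with _ | j
    · simp
    · have : (Finsupp.single (0 : Fin 2) i + Finsupp.single 1 (j + 1) - Finsupp.single 1 1) =
          Finsupp.single 0 i + Finsupp.single 1 j := by
        ext k; fin_cases k <;> simp
      rw [this, if_pos (by simp), if_neg (by omega), lie_smul, Nat.add_sub_cancel]

lemma biDeriv_tmul (s : Fin 2) (f : MvPolynomial (Fin 2) K) (l : L) :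
    biDeriv K L s (f ⊗ₜ l) = MvPolynomial.pderiv s f ⊗ₜ l := rfl

lemma biCoeff_biDeriv_zero (i j : ℕ) (q : MvPolynomial (Fin 2) K ⊗[K] L) :
    biCoeff K L i j (biDeriv K L 0 q) = ((i + 1 : ℕ) : K) • biCoeff K L (i + 1) j q := by
  induction q with
  | zero => simp
  | add a b ha hb => simp only [map_add, ha, hb, smul_add]
  | tmul f l =>
    rw [biDeriv_tmul, biCoeff_tmul, biCoeff_tmul, MvPolynomial.coeff_pderiv, smul_smul,
      show Finsupp.single (0 : Fin 2) i + Finsupp.single 1 j + Finsupp.single 0 1 =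
      Finsupp.single 0 (i + 1) + Finsupp.single 1 j by ext k; fin_cases k <;> simp]
    simp [mul_comm]

lemma biCoeff_biDeriv_one (i j : ℕ) (q : MvPolynomial (Fin 2) K ⊗[K] L) :
    biCoeff K L i j (biDeriv K L 1 q) = ((j + 1 : ℕ) : K) • biCoeff K L i (j + 1) q := by
  induction q with
  | zero => simp
  | add a b ha hb => simp only [map_add, ha, hb, smul_add]
  | tmul f l =>
    rw [biDeriv_tmul, biCoeff_tmul, biCoeff_tmul, MvPolynomial.coeff_pderiv, smul_smul,
      show Finsupp.single (0 : Fin 2) i + Finsupp.single 1 j + Finsupp.single 1 1 =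
      Finsupp.single 0 i + Finsupp.single 1 (j + 1) by ext k; fin_cases k <;> simp]
    simp [mul_comm]

lemma biDeriv_extAd (s : Fin 2) (t q : MvPolynomial (Fin 2) K ⊗[K] L) :
    biDeriv K L s (extAd K L t q) =
      extAd K L (biDeriv K L s t) q + extAd K L t (biDeriv K L s q) := by
  induction t with
  | zero => simp
  | add a b ha hb => simp only [map_add, ha, hb, LinearMap.add_apply]; abel
  | tmul g m =>
    induction q with
    | zero => simp
    | add a b ha hb => simp only [map_add, ha, hb]; abel
    | tmul f l =>
      simp only [biDeriv_tmul, extAd_tmul, Derivation.leibniz, smul_eq_mul,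
        TensorProduct.add_tmul]
      rw [mul_comm f, add_comm]

lemma biDeriv_zero_biElt (x y z : L) : biDeriv K L 0 (biElt K x y z) = 1 ⊗ₜ z := by
  simp [biDeriv_tmul, biElt]

lemma biDeriv_one_biElt (x y z : L) : biDeriv K L 1 (biElt K x y z) = 1 ⊗ₜ x := by
  simp [biDeriv_tmul, biElt]

/-- The coefficient of `σ^i τ^j` of `(ad_{σ z + τ x + y})^n (w)`. -/
noncomputable def biAd (K : Type*) {L : Type*} [Field K] [LieRing L] [LieAlgebra K L]
    (x y z : L) (n i j : ℕ) (w : L) : L :=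
  biCoeff K L i j ((extAd K L (biElt K x y z) ^ n) (1 ⊗ₜ w))

lemma biDeriv_ad_pow (s : Fin 2) (t : MvPolynomial (Fin 2) K ⊗[K] L) (w : L) (n : ℕ) :
    biDeriv K L s ((extAd K L t ^ n) (1 ⊗ₜ w)) =
      ∑ a ∈ range n, (extAd K L t ^ a)
        (extAd K L (biDeriv K L s t) ((extAd K L t ^ (n - 1 - a)) (1 ⊗ₜ w))) := by
  induction n with
  | zero => simp [biDeriv_tmul]
  | succ n ih =>
    rw [pow_succ', Module.End.mul_apply, biDeriv_extAd, ih, sum_range_succ',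
      map_sum, add_comm]
    congr 1
    refine sum_congr rfl fun a _ => ?_
    rw [pow_succ', Module.End.mul_apply,
      show n + 1 - 1 - (a + 1) = n - 1 - a by omega]

/-- Closedness read off at `σ^i τ^j`: the `τ`-derivative of `ω(z)` equals the `σ`-derivative of
`ω(x)` at the point `σ z + τ x + y`. -/
lemma biAd_closed (p : ℕ) [hp : Fact p.Prime] [CharP K p] (hodd : Odd p) (x y z : L) (i j : ℕ) :
    ((j + 1 : ℕ) : K) • biAd K x y z (p - 1) i (j + 1) z =
      ((i + 1 : ℕ) : K) • biAd K x y z (p - 1) (i + 1) j x := by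
  rw [biAd, biAd, ← biCoeff_biDeriv_one, ← biCoeff_biDeriv_zero, biDeriv_ad_pow, biDeriv_ad_pow,
    biDeriv_zero_biElt, biDeriv_one_biElt, show p - 1 - 1 = p - 2 by omega]
  congr 1
  exact sum_ad_pow_lie_comm p hodd _ _ _

lemma biAd_zero (x y z : L) (i j : ℕ) (w : L) :
    biAd K x y z 0 i j w = if i = 0 ∧ j = 0 then w else 0 := by
  rw [biAd, pow_zero, Module.End.one_apply, biCoeff_tmul, MvPolynomial.coeff_one]
  by_cases h : i = 0 ∧ j = 0
  · simp [h]
  · rw [if_neg h, if_neg, zero_smul]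
    intro h0
    exact h ⟨by simpa using (DFunLike.congr_fun h0 0).symm,
      by simpa using (DFunLike.congr_fun h0 1).symm⟩

lemma biAd_succ (x y z : L) (n i j : ℕ) (w : L) :
    biAd K x y z (n + 1) i j w = (if i = 0 then 0 else ⁅z, biAd K x y z n (i - 1) j w⁆) +
      (if j = 0 then 0 else ⁅x, biAd K x y z n i (j - 1) w⁆) + ⁅y, biAd K x y z n i j w⁆ := by
  rw [biAd, pow_succ', Module.End.mul_apply]
  nth_rewrite 1 [biElt]
  rw [map_add, map_add, LinearMap.add_apply, LinearMap.add_apply, map_add, map_add,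
    biCoeff_extAd_X_zero, biCoeff_extAd_X_one, biCoeff_extAd_one]
  rfl

lemma biAd_eq_zero (x y z w : L) {n i j : ℕ} (h : n < i + j) : biAd K x y z n i j w = 0 := by
  induction n generalizing i j with
  | zero => rw [biAd_zero, if_neg (by omega)]
  | succ n ih =>
    rw [biAd_succ, ih (by omega : n < i + j)]
    split_ifs with h1 h2 h2
    · simp
    · rw [ih (by omega)]; simp
    · rw [ih (by omega)]; simp
    · rw [ih (by omega), ih (by omega)]; simp

lemma biAd_swap (x y z w : L) (n i j : ℕ) : biAd K z y x n j i w = biAd K x y z n i j w := by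
  induction n generalizing i j with
  | zero => simp only [biAd_zero, and_comm]
  | succ n ih => rw [biAd_succ, biAd_succ, ih, ih, ih]; abel

lemma coeff_adLam_lieBr_pow (x y z w : L) (n i : ℕ) :
    ((adLam (lieBr K L) z y ^ n).coeff i) w = biAd K x y z n i 0 w := by
  induction n generalizing i with
  | zero => rw [coeff_adLam_pow_zero, biAd_zero]; simp
  | succ n ih =>
    rcases i with _ | i
    · simp [coeff_adLam_pow_succ_zero, biAd_succ, ih]
    · simp [coeff_adLam_pow_succ_succ, biAd_succ, ih]

/-- Moving the base point from `y` to `x + y` means putting `τ = 1`, i.e. summing over all degrees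
in `τ`; `n < N` ensures that none is missed. -/
lemma coeff_adLam_lieBr_pow_add (x y z w : L) {n N : ℕ} (hN : n < N) (i : ℕ) :
    ((adLam (lieBr K L) z (x + y) ^ n).coeff i) w = ∑ j ∈ range N, biAd K x y z n i j w := by
  induction n generalizing i with
  | zero =>
    rw [coeff_adLam_pow_zero, sum_eq_single 0]
    · simp [biAd_zero]
    · intro j _ hj; rw [biAd_zero, if_neg (by omega)]
    · intro h; exact absurd (mem_range.2 (by omega)) h
  | succ n ih =>
    have hx : ∀ i, ∑ j ∈ range N, (if j = 0 then 0 else ⁅x, biAd K x y z n i (j - 1) w⁆) =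
        ⁅x, ∑ j ∈ range N, biAd K x y z n i j w⁆ := by
      intro i
      obtain ⟨N, rfl⟩ : ∃ M, N = M + 1 := ⟨N - 1, by omega⟩
      rw [sum_range_succ', sum_range_succ, biAd_eq_zero x y z w (by omega : n < i + N)]
      simp [lie_sum]
    rcases i with _ | i
    · simp only [coeff_adLam_pow_succ_zero, ih (by omega), biAd_succ, sum_add_distrib, hx,
        lieBr_apply, add_lie, if_true, zero_add, lie_sum]
    · simp only [coeff_adLam_pow_succ_succ, ih (by omega), biAd_succ, sum_add_distrib, hx,
        lieBr_apply, add_lie, lie_sum, Nat.succ_ne_zero, if_false, Nat.add_sub_cancel]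
      abel

/-- The sum of the `s_i` is a cocycle. -/
theorem sSum_lieBr_cocycle (p : ℕ) [hp : Fact p.Prime] [CharP K p] (hodd : Odd p) (x y z : L) :
    sSum p (lieBr K L) x y + sSum p (lieBr K L) z (x + y) =
      sSum p (lieBr K L) z y + sSum p (lieBr K L) x (z + y) := by
  have hp1 := hp.out.one_lt
  have hN : p - 1 < (p - 1) + 1 := by omega
  -- Closedness divided by `(i+1)(j+1)`, which is invertible because `i, j < p - 1`.
  have key : ∀ i ∈ range (p - 1), ∀ j ∈ range (p - 1),
      ((i + 1 : ℕ) : K)⁻¹ • biAd K x y z (p - 1) i (j + 1) z =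
        ((j + 1 : ℕ) : K)⁻¹ • biAd K x y z (p - 1) (i + 1) j x := by
    intro i hi j hj
    have hne : ∀ k ∈ range (p - 1), ((k + 1 : ℕ) : K) ≠ 0 := by
      intro k hk h0
      have := mem_range.1 hk
      exact Nat.not_dvd_of_pos_of_lt (by omega) (by omega) ((CharP.cast_eq_zero_iff K p _).1 h0)
    have h := biAd_closed p hodd (K := K) x y z i j
    rw [inv_smul_eq_iff₀ (hne i hi), smul_comm, ← h, inv_smul_smul₀ (hne j hj)]
  have e1 : ∀ i w, ((adLam (lieBr K L) x y ^ (p - 1)).coeff i) w = biAd K x y z (p - 1) 0 i w := by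
    intro i w
    rw [coeff_adLam_lieBr_pow z y x, biAd_swap]
  have e2 : ∀ i w, ((adLam (lieBr K L) x (z + y) ^ (p - 1)).coeff i) w =
      ∑ j ∈ range (p - 1 + 1), biAd K x y z (p - 1) j i w := by
    intro i w
    rw [coeff_adLam_lieBr_pow_add z y x w hN]
    exact sum_congr rfl fun j _ => biAd_swap x y z w _ _ _
  -- On the two sides of the parallelogram away from `y`, the terms of degree `0` in the other
  -- variable reproduce the sides through `y`; these occur in both members. The remaining double
  -- sums agree by `key`.
  simp only [sSum_eq_sum_range, e1, e2, coeff_adLam_lieBr_pow x y z,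
    coeff_adLam_lieBr_pow_add x y z z hN, sum_range_succ' _ (p - 1), smul_add, sum_add_distrib,
    smul_sum]
  rw [sum_comm (f := fun i j => ((i + 1 : ℕ) : K)⁻¹ • biAd K x y z (p - 1) (j + 1) i x),
    sum_congr rfl fun i hi => sum_congr rfl fun j hj => key i hi j hj]
  abel

end Bivariate

/-! ### Jacobson's formula in an associative algebra -/

section Jacobson

variable {K : Type*} [Field K] {E : Type*} [Ring E] [Algebra K E]

/-- The commutator of an associative algebra as a bilinear map. -/
noncomputable def commBr (K E : Type*) [Field K] [Ring E] [Algebra K E] : E →ₗ[K] E →ₗ[K] E :=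
  LinearMap.mul K E - (LinearMap.mul K E).flip

@[simp] lemma commBr_apply (a b : E) : commBr K E a b = a * b - b * a := rfl

/-- The polynomial `λ a + b`. -/
noncomputable def lamPoly (a b : E) : Polynomial E :=
  Polynomial.X * Polynomial.C a + Polynomial.C b

lemma coeff_lamPoly_mul_zero (a b : E) (q : Polynomial E) :
    (lamPoly a b * q).coeff 0 = b * q.coeff 0 := by
  rw [lamPoly, add_mul, Polynomial.coeff_add, mul_assoc]
  simp

lemma coeff_lamPoly_mul_succ (a b : E) (q : Polynomial E) (i : ℕ) :
    (lamPoly a b * q).coeff (i + 1) = a * q.coeff i + b * q.coeff (i + 1) := by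
  rw [lamPoly, add_mul, Polynomial.coeff_add, mul_assoc]
  simp

lemma coeff_mul_lamPoly_zero (a b : E) (q : Polynomial E) :
    (q * lamPoly a b).coeff 0 = q.coeff 0 * b := by
  rw [lamPoly, mul_add, Polynomial.coeff_add, ← mul_assoc]
  simp

lemma coeff_mul_lamPoly_succ (a b : E) (q : Polynomial E) (i : ℕ) :
    (q * lamPoly a b).coeff (i + 1) = q.coeff i * a + q.coeff (i + 1) * b := by
  rw [lamPoly, mul_add, Polynomial.coeff_add, ← mul_assoc]
  simp

lemma coeff_lamPoly_pow_zero (a b : E) (n : ℕ) : (lamPoly a b ^ n).coeff 0 = b ^ n := by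
  induction n with
  | zero => simp
  | succ n ih => rw [pow_succ', coeff_lamPoly_mul_zero, ih, pow_succ']

lemma coeff_lamPoly_pow_eq_zero (a b : E) {n i : ℕ} (h : n < i) :
    (lamPoly a b ^ n).coeff i = 0 := by
  induction n generalizing i with
  | zero => rw [pow_zero, Polynomial.coeff_one, if_neg (by omega)]
  | succ n ih =>
    obtain ⟨i, rfl⟩ : ∃ k, i = k + 1 := ⟨i - 1, by omega⟩
    rw [pow_succ', coeff_lamPoly_mul_succ, ih (by omega), ih (by omega)]
    simp

lemma coeff_lamPoly_pow_self (a b : E) (n : ℕ) : (lamPoly a b ^ n).coeff n = a ^ n := by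
  induction n with
  | zero => simp
  | succ n ih =>
    rw [pow_succ', coeff_lamPoly_mul_succ, ih, coeff_lamPoly_pow_eq_zero a b (Nat.lt_succ_self n),
      pow_succ', mul_zero, add_zero]

lemma sum_coeff_lamPoly_pow (a b : E) (n : ℕ) :
    ∑ i ∈ range (n + 1), (lamPoly a b ^ n).coeff i = (a + b) ^ n := by
  induction n with
  | zero => simp
  | succ n ih =>
    have h1 := sum_range_succ' (fun i => (lamPoly a b ^ n).coeff i) (n + 1)
    rw [sum_range_succ, coeff_lamPoly_pow_eq_zero a b (Nat.lt_succ_self n), add_zero, ih] at h1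
    rw [sum_range_succ', pow_succ', coeff_lamPoly_mul_zero]
    simp only [coeff_lamPoly_mul_succ, sum_add_distrib, ← mul_sum, ih]
    rw [add_assoc, ← mul_add, ← h1, ← add_mul, pow_succ']

lemma derivative_lamPoly_pow (a b : E) (n : ℕ) :
    Polynomial.derivative (lamPoly a b ^ n) =
      ∑ i ∈ range n, lamPoly a b ^ i * (Polynomial.C a * lamPoly a b ^ (n - 1 - i)) := by
  induction n with
  | zero => simp
  | succ n ih =>
    rw [pow_succ', Polynomial.derivative_mul, ih, sum_range_succ', mul_sum, add_comm]
    congr 1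
    · refine sum_congr rfl fun i _ => ?_
      rw [pow_succ', mul_assoc, show n + 1 - 1 - (i + 1) = n - 1 - i by omega]
    · simp [lamPoly]

/-- For the commutator, `ad` is left minus right multiplication by `λa + b` on `E[λ]`. These two
operators commute, so the binomial theorem becomes available. -/
lemma coeff_adLam_commBr_pow (a b c : E) (n i : ℕ) :
    ((adLam (commBr K E) a b ^ n).coeff i) c =
      (((LinearMap.mulLeft K (lamPoly a b) - LinearMap.mulRight K (lamPoly a b)) ^ n)
        (Polynomial.C c)).coeff i := by
  induction n generalizing i with
  | zero =>
    rw [coeff_adLam_pow_zero, pow_zero, Module.End.one_apply, Polynomial.coeff_C]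
  | succ n ih =>
    rw [pow_succ' (_ - _), Module.End.mul_apply, LinearMap.sub_apply, LinearMap.mulLeft_apply,
      LinearMap.mulRight_apply, Polynomial.coeff_sub]
    rcases i with _ | i
    · rw [coeff_adLam_pow_succ_zero, ih, coeff_lamPoly_mul_zero, coeff_mul_lamPoly_zero,
        commBr_apply]
    · rw [coeff_adLam_pow_succ_succ, ih, ih, coeff_lamPoly_mul_succ, coeff_mul_lamPoly_succ,
        commBr_apply, commBr_apply]
      abel

/-- Jacobson's formula for the `p`-th power of a sum. -/
theorem add_pow_char_eq_add_sSum (p : ℕ) [hp : Fact p.Prime] [CharP K p] (hodd : Odd p) (a b : E) :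
    (a + b) ^ p = a ^ p + b ^ p + sSum p (commBr K E) a b := by
  have hp1 := hp.out.one_lt
  have hpE : ((p : ℕ) : Module.End K (Polynomial E)) = 0 := by
    rw [← map_natCast (algebraMap K (Module.End K (Polynomial E))), CharP.cast_eq_zero, map_zero]
  -- Modulo `p`, `(L - R)^{p-1} = ∑ L^i R^{p-1-i}`; applied to `a` this is the noncommutative
  -- product rule for `(λa + b)^p`.
  have hd : ((LinearMap.mulLeft K (lamPoly a b) - LinearMap.mulRight K (lamPoly a b)) ^ (p - 1))
      (Polynomial.C a) = Polynomial.derivative (lamPoly a b ^ p) := by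
    rw [sub_pow_pred_of_commute p hpE hodd (LinearMap.commute_mulLeft_right _ _),
      derivative_lamPoly_pow, LinearMap.sum_apply]
    refine sum_congr rfl fun i _ => ?_
    rw [Module.End.mul_apply, LinearMap.pow_mulLeft, LinearMap.pow_mulRight,
      LinearMap.mulLeft_apply, LinearMap.mulRight_apply]
  have hs : sSum p (commBr K E) a b = ∑ i ∈ range (p - 1), (lamPoly a b ^ p).coeff (i + 1) := by
    rw [sSum_eq_sum_range]
    refine sum_congr rfl fun i hi => ?_
    have hi' := mem_range.1 hi
    have hne : ((i + 1 : ℕ) : K) ≠ 0 := fun h0 =>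
      Nat.not_dvd_of_pos_of_lt (by omega) (by omega) ((CharP.cast_eq_zero_iff K p _).1 h0)
    rw [coeff_adLam_commBr_pow, hd, Polynomial.coeff_derivative, inv_smul_eq_iff₀ hne,
      Nat.cast_smul_eq_nsmul, nsmul_eq_mul, Nat.cast_add, Nat.cast_one, ← Nat.cast_succ,
      (Nat.cast_commute _ _).eq]
  obtain ⟨m, rfl⟩ : ∃ m, p = m + 1 := ⟨p - 1, by omega⟩
  -- Put `λ = 1` in `(λa + b)^p`: the extreme coefficients are `b^p` and `a^p`, the others are the
  -- `s_i`.
  rw [← sum_coeff_lamPoly_pow, sum_range_succ, coeff_lamPoly_pow_self, sum_range_succ',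
    coeff_lamPoly_pow_zero, hs, Nat.add_sub_cancel]
  abel

end Jacobson

/-! ### Naturality, homogeneity and central invariance of `∑ s_i` -/

section Naturality

variable {K : Type*} [Field K] {A A' : Type*} [AddCommGroup A] [Module K A]
  [AddCommGroup A'] [Module K A']

lemma map_coeff_adLam_pow {br : A →ₗ[K] A →ₗ[K] A} {br' : A' →ₗ[K] A' →ₗ[K] A'} (f : A →ₗ[K] A')
    (hf : ∀ x y, f (br x y) = br' (f x) (f y)) (a b c : A) (n i : ℕ) :
    f (((adLam br a b ^ n).coeff i) c) = ((adLam br' (f a) (f b) ^ n).coeff i) (f c) := by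
  induction n generalizing i with
  | zero => rw [coeff_adLam_pow_zero, coeff_adLam_pow_zero]; split_ifs <;> simp
  | succ n ih =>
    rcases i with _ | i
    · rw [coeff_adLam_pow_succ_zero, coeff_adLam_pow_succ_zero, hf, ih]
    · rw [coeff_adLam_pow_succ_succ, coeff_adLam_pow_succ_succ, map_add, hf, hf, ih, ih]

/-- The `s_i` are iterated brackets, so every bracket-preserving linear map respects them. This
transfers results between `𝔞_0`, `𝔞`, `End 𝔞` and `𝔤`. -/
lemma map_sSum {br : A →ₗ[K] A →ₗ[K] A} {br' : A' →ₗ[K] A' →ₗ[K] A'} (f : A →ₗ[K] A')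
    (hf : ∀ x y, f (br x y) = br' (f x) (f y)) (p : ℕ) (a b : A) :
    f (sSum p br a b) = sSum p br' (f a) (f b) := by
  simp only [sSum_eq_sum_range, map_sum, map_smul, map_coeff_adLam_pow f hf]

lemma coeff_adLam_pow_eq_zero {br : A →ₗ[K] A →ₗ[K] A} {a b c : A} (ha : br a c = 0)
    (hb : br b c = 0) {n : ℕ} (hn : n ≠ 0) (i : ℕ) : ((adLam br a b ^ n).coeff i) c = 0 := by
  obtain ⟨n, rfl⟩ := Nat.exists_eq_succ_of_ne_zero hn
  induction n generalizing i with
  | zero =>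
    rcases i with _ | i
    · simpa [adLam] using hb
    · rw [coeff_adLam_pow_succ_succ, coeff_adLam_pow_zero, coeff_adLam_pow_zero]
      split_ifs <;> simp_all
  | succ n ih =>
    rcases i with _ | i
    · rw [coeff_adLam_pow_succ_zero, ih (hn := n.succ_ne_zero), map_zero]
    · rw [coeff_adLam_pow_succ_succ, ih (hn := n.succ_ne_zero), ih (hn := n.succ_ne_zero), map_zero, map_zero,
        add_zero]

lemma sSum_eq_zero {p : ℕ} (hp : 2 ≤ p) {br : A →ₗ[K] A →ₗ[K] A} {a b : A} (ha : br a a = 0)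
    (hb : br b a = 0) : sSum p br a b = 0 := by
  rw [sSum_eq_sum_range]
  refine sum_eq_zero fun i _ => ?_
  rw [coeff_adLam_pow_eq_zero ha hb (by omega), smul_zero]

lemma coeff_adLam_smul_pow (br : A →ₗ[K] A →ₗ[K] A) (r : K) (a b c : A) (n i : ℕ) :
    ((adLam br (r • a) (r • b) ^ n).coeff i) c = r ^ n • ((adLam br a b ^ n).coeff i) c := by
  induction n generalizing i with
  | zero => simp
  | succ n ih =>
    rcases i with _ | i
    · simp only [coeff_adLam_pow_succ_zero, ih, map_smul, LinearMap.smul_apply, smul_smul,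
        pow_succ r n]
    · simp only [coeff_adLam_pow_succ_succ, ih, map_smul, LinearMap.smul_apply, smul_smul,
        pow_succ r n, smul_add]

lemma sSum_smul {p : ℕ} (hp : p ≠ 0) (br : A →ₗ[K] A →ₗ[K] A) (r : K) (a b : A) :
    sSum p br (r • a) (r • b) = r ^ p • sSum p br a b := by
  obtain ⟨m, rfl⟩ := Nat.exists_eq_succ_of_ne_zero hp
  simp only [sSum_eq_sum_range, smul_sum, coeff_adLam_smul_pow, map_smul, smul_smul,
    Nat.succ_sub_one, pow_succ]
  refine sum_congr rfl fun i _ => ?_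
  congr 1
  ring

lemma adLam_congr {br : A →ₗ[K] A →ₗ[K] A} {a a' b b' : A} (ha : br a = br a')
    (hb : br b = br b') : adLam br a b = adLam br a' b' := by
  rw [adLam, adLam, ha, hb]

/-- The sum of the `s_i` does not change if central elements are added to its arguments. -/
lemma sSum_congr {p : ℕ} (hp : 2 ≤ p) {br : A →ₗ[K] A →ₗ[K] A} {a a' b b' : A} (ha : br a = br a')
    (hb : br b = br b') (ha1 : br a a = br a a') (hb1 : br b a = br b a') :
    sSum p br a b = sSum p br a' b' := by
  rw [sSum_eq_sum_range, sSum_eq_sum_range, adLam_congr ha hb]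
  refine sum_congr rfl fun i _ => ?_
  congr 1
  rw [← sub_eq_zero, ← map_sub]
  refine coeff_adLam_pow_eq_zero ?_ ?_ (by omega) i
  · rw [← ha, map_sub, ha1, sub_self]
  · rw [← hb, map_sub, hb1, sub_self]

end Naturality

/-! ### The even part as a Lie algebra acting on the superalgebra -/

section EvenPart

variable {K : Type*} [Field K] {A : Type*} [AddCommGroup A] [Module K A]
  {gr : ZMod 2 → Submodule K A} {br : A →ₗ[K] A →ₗ[K] A}

namespace IsLieSuperalgebra

lemma bracket_mem_even (hL : IsLieSuperalgebra gr br) {a b : A} (ha : a ∈ gr 0) (hb : b ∈ gr 0) :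
    br a b ∈ gr 0 := hL.bracket_mem 0 0 a b ha hb

lemma exists_even_add_odd (hL : IsLieSuperalgebra gr br) (a : A) :
    ∃ a₀ ∈ gr 0, ∃ a₁ ∈ gr 1, a = a₀ + a₁ := by
  have h := ((DirectSum.isInternal_submodule_iff_isCompl gr (i := 0) (j := 1) (by decide)
    (Set.eq_univ_of_forall (by decide : ∀ i : ZMod 2, i = 0 ∨ i = 1)).symm).1 hL.isInternal).sup_eq_top
  obtain ⟨a₀, h₀, a₁, h₁, e⟩ := Submodule.mem_sup.1 (h ▸ Submodule.mem_top : a ∈ gr 0 ⊔ gr 1)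
  exact ⟨a₀, h₀, a₁, h₁, e.symm⟩

lemma skew_even (hL : IsLieSuperalgebra gr br) {a : A} (ha : a ∈ gr 0) (b : A) :
    br a b = -br b a := by
  obtain ⟨b₀, h₀, b₁, h₁, rfl⟩ := hL.exists_even_add_odd b
  have e0 := hL.skew 0 0 a b₀ ha h₀
  have e1 := hL.skew 0 1 a b₁ ha h₁
  simp at e0 e1
  rw [map_add, e0, e1, map_add, LinearMap.add_apply]
  abel

lemma jacobi_even (hL : IsLieSuperalgebra gr br) {a b : A} (ha : a ∈ gr 0) (hb : b ∈ gr 0)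
    (c : A) : br a (br b c) = br (br a b) c + br b (br a c) := by
  obtain ⟨c₀, h₀, c₁, h₁, rfl⟩ := hL.exists_even_add_odd c
  have e0 := hL.jacobi 0 0 0 a b c₀ ha hb h₀
  have e1 := hL.jacobi 0 0 1 a b c₁ ha hb h₁
  simp at e0 e1
  simp only [map_add, e0, e1]
  abel

lemma bracket_self_even (hL : IsLieSuperalgebra gr br) (h2 : (2 : K) ≠ 0) {a : A} (ha : a ∈ gr 0) :
    br a a = 0 := by
  have h := hL.skew_even ha a
  have : (2 : K) • br a a = 0 := by
    rw [two_smul]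
    nth_rewrite 1 [h]
    exact neg_add_cancel _
  exact (smul_eq_zero.1 this).resolve_left h2

/-- The even part of a Lie superalgebra is a Lie ring. -/
abbrev evenLieRing (hL : IsLieSuperalgebra gr br) (h2 : (2 : K) ≠ 0) : LieRing (gr 0) where
  bracket a b := ⟨br a b, hL.bracket_mem_even a.2 b.2⟩
  add_lie a b c := Subtype.ext (by simp)
  lie_add a b c := Subtype.ext (by simp)
  lie_self a := Subtype.ext (hL.bracket_self_even h2 a.2)
  leibniz_lie a b c := Subtype.ext (hL.jacobi_even a.2 b.2 c)

/-- The even part of a Lie superalgebra is a Lie algebra. -/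
abbrev evenLieAlgebra (hL : IsLieSuperalgebra gr br) (h2 : (2 : K) ≠ 0) :
    letI := hL.evenLieRing h2
    LieAlgebra K (gr 0) :=
  letI := hL.evenLieRing h2
  { lie_smul := fun r a b => Subtype.ext (by
      change br (a : A) (r • (b : A)) = r • br (a : A) (b : A)
      rw [map_smul]) }

variable {p : ℕ}

lemma sSum_mem (hL : IsLieSuperalgebra gr br) (h2 : (2 : K) ≠ 0) {a b : A} (ha : a ∈ gr 0)
    (hb : b ∈ gr 0) : sSum p br a b ∈ gr 0 := by
  let _ := hL.evenLieRing h2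
  let _ := hL.evenLieAlgebra h2
  have := map_sSum (br := lieBr K (gr 0)) (br' := br) (gr 0).subtype (fun x y => rfl) p
    ⟨a, ha⟩ ⟨b, hb⟩
  exact this ▸ Subtype.mem _

/-- A `p|2p`-structure is given by its map on the even part. -/
def mkP2p (hL : IsLieSuperalgebra gr br) (f : gr 0 → gr 0)
    (h2 : (2 : K) ≠ 0)
    (had : ∀ a : gr 0, (br (f a : A) : Module.End K A) = (br (a : A) : Module.End K A) ^ p)
    (hsmul : ∀ (c : K) (a : gr 0), f (c • a) = c ^ p • f a)
    (hadd : ∀ a b : gr 0, (f (a + b) : A) = f a + f b + sSum p br (a : A) (b : A)) :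
    P2pStructure p gr br where
  pMap := f
  twoPMap a := f ((2 : K)⁻¹ • ⟨br a a, hL.bracket_mem 1 1 a a a.2 a.2⟩)
  ad_pMap := had
  pMap_smul := hsmul
  pMap_add := hadd
  twoPMap_eq a s hs := by
    congr 1
    refine Subtype.ext ?_
    change (2 : K)⁻¹ • br (a : A) (a : A) = s
    rw [← hs, inv_smul_smul₀ h2]

/-- The map on the odd part is forced: half of `[a,a]` exists and is even, as `2` is invertible. -/
lemma P2p_ext (hL : IsLieSuperalgebra gr br) (h2 : (2 : K) ≠ 0) {S T : P2pStructure p gr br}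
    (h : ∀ a, S.pMap a = T.pMap a) : S = T := by
  have h' : S.twoPMap = T.twoPMap := by
    funext a
    have e : (2 : K) • (((2 : K)⁻¹ • ⟨br a a, hL.bracket_mem 1 1 a a a.2 a.2⟩ : gr 0) : A) =
        br (a : A) (a : A) := smul_inv_smul₀ h2 _
    rw [S.twoPMap_eq a _ e, T.twoPMap_eq a _ e, h]
  have h0 : S.pMap = T.pMap := funext h
  cases S
  cases T
  cases h0
  cases h'
  rfl

variable [hp : Fact p.Prime] [CharP K p]

lemma sSum_cocycle (hL : IsLieSuperalgebra gr br) (h2 : (2 : K) ≠ 0) (hodd : Odd p) {x y z : A}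
    (hx : x ∈ gr 0) (hy : y ∈ gr 0) (hz : z ∈ gr 0) :
    sSum p br x y + sSum p br z (x + y) = sSum p br z y + sSum p br x (z + y) := by
  let _ := hL.evenLieRing h2
  let _ := hL.evenLieAlgebra h2
  have h := congrArg (gr 0).subtype
    (sSum_lieBr_cocycle (K := K) (L := gr 0) p hodd ⟨x, hx⟩ ⟨y, hy⟩ ⟨z, hz⟩)
  simp only [map_add, map_sSum (br := lieBr K (gr 0)) (br' := br) (gr 0).subtype (fun x y => rfl)]
    at h
  exact h

lemma sSum_comm (hL : IsLieSuperalgebra gr br) (h2 : (2 : K) ≠ 0) (hodd : Odd p) {x z : A}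
    (hx : x ∈ gr 0) (hz : z ∈ gr 0) : sSum p br x z = sSum p br z x := by
  have h := hL.sSum_cocycle (p := p) h2 hodd hx (zero_mem _) hz
  rw [sSum_eq_zero (b := 0) hp.out.two_le (hL.bracket_self_even h2 hx) (by simp),
    sSum_eq_zero (b := 0) hp.out.two_le (hL.bracket_self_even h2 hz) (by simp)] at h
  simpa using h.symm

/-- Both sides are the correction for expanding the `p`-map of `a + b + v + w`, under two different
bracketings. It combines three instances of the cocycle identity with symmetry. -/
lemma sSum_add_add (hL : IsLieSuperalgebra gr br) (h2 : (2 : K) ≠ 0) (hodd : Odd p) {a b v w : A}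
    (ha : a ∈ gr 0) (hb : b ∈ gr 0) (hv : v ∈ gr 0) (hw : w ∈ gr 0) :
    sSum p br a b + sSum p br v w + sSum p br (a + b) (v + w) =
      sSum p br a v + sSum p br b w + sSum p br (a + v) (b + w) := by
  have hbw := add_mem hb hw
  have hvw := add_mem hv hw
  have h1 := hL.sSum_cocycle (p := p) h2 hodd ha hb hvw
  have h2' := hL.sSum_cocycle (p := p) h2 hodd ha hv hbw
  have h3 := hL.sSum_cocycle (p := p) h2 hodd hv hw hb
  rw [hL.sSum_comm h2 hodd hvw (add_mem ha hb)] at h1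
  rw [hL.sSum_comm h2 hodd hbw (add_mem ha hv)] at h2'
  rw [hL.sSum_comm h2 hodd hvw hb] at h1
  rw [hL.sSum_comm h2 hodd hbw hv] at h2'
  rw [show v + w + b = b + w + v by abel] at h1
  linear_combination (norm := module) h1 - h2' + h3

/-- By the Jacobi identity `ad` maps the even part into the commutator algebra of `End A`, where
Jacobson's formula applies. It thus holds on the odd part of the module as well. -/
lemma bracket_sSum (hL : IsLieSuperalgebra gr br) (h2 : (2 : K) ≠ 0) (hodd : Odd p) {a b : A}
    (ha : a ∈ gr 0) (hb : b ∈ gr 0) :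
    ((br a : Module.End K A) + (br b : Module.End K A)) ^ p =
      (br a : Module.End K A) ^ p + (br b : Module.End K A) ^ p + br (sSum p br a b) := by
  let _ := hL.evenLieRing h2
  let _ := hL.evenLieAlgebra h2
  let f : gr 0 →ₗ[K] Module.End K A := br ∘ₗ (gr 0).subtype
  have hf : ∀ x y, f (lieBr K (gr 0) x y) = commBr K (Module.End K A) (f x) (f y) := by
    intro x y
    refine LinearMap.ext fun c => ?_
    have := hL.jacobi_even x.2 y.2 c
    change br (br x y) c = br x (br y c) - br y (br x c)
    rw [this, add_sub_cancel_right]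
  rw [add_pow_char_eq_add_sSum (K := K) p hodd]
  congr 1
  have h1 := map_sSum f hf p ⟨a, ha⟩ ⟨b, hb⟩
  have h3 := map_sSum (br := lieBr K (gr 0)) (br' := br) (gr 0).subtype (fun x y => rfl) p
    ⟨a, ha⟩ ⟨b, hb⟩
  simp only [Submodule.subtype_apply] at h3
  rw [← h3]
  exact h1.symm

end IsLieSuperalgebra

end EvenPart

/-! ### Gluing `p`-maps along `K x ⊕ H ⊕ K t` -/

section SplitExtension

variable {K : Type*} [Field K] {A : Type*} [AddCommGroup A] [Module K A]
  {gr : ZMod 2 → Submodule K A} {br : A →ₗ[K] A →ₗ[K] A} {p : ℕ}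

lemma P2pStructure.pMap_add_sSum (S : P2pStructure p gr br) (a b : gr 0) :
    (S.pMap (a + b) : A) = S.pMap a + S.pMap b + sSum p br (a : A) (b : A) := S.pMap_add a b

variable {H : Type*} [AddCommGroup H] [Module K H]

/-- A decomposition `V = K x ⊕ H ⊕ K t`. -/
structure SplitDecomp (K : Type*) [Field K] (V H : Type*) [AddCommGroup V] [Module K V]
    [AddCommGroup H] [Module K H] where
  x : V
  t : V
  incl : H →ₗ[K] V
  xCoord : V →ₗ[K] K
  proj : V →ₗ[K] H
  tCoord : V →ₗ[K] K
  decomp : ∀ X, X = xCoord X • x + incl (proj X) + tCoord X • t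
  xCoord_x : xCoord x = 1
  proj_x : proj x = 0
  tCoord_x : tCoord x = 0
  xCoord_t : xCoord t = 0
  proj_t : proj t = 0
  tCoord_t : tCoord t = 1
  xCoord_incl : ∀ a, xCoord (incl a) = 0
  proj_incl : ∀ a, proj (incl a) = a
  tCoord_incl : ∀ a, tCoord (incl a) = 0

/-- A `p|2p`-structure is determined by its values on `H`, `x` and `t`. -/
lemma SplitDecomp.P2p_ext (s : SplitDecomp K (gr 0) H) (hL : IsLieSuperalgebra gr br)
    (h2 : (2 : K) ≠ 0) {S T : P2pStructure p gr br} (hx : S.pMap s.x = T.pMap s.x)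
    (ht : S.pMap s.t = T.pMap s.t) (hH : ∀ a, S.pMap (s.incl a) = T.pMap (s.incl a)) : S = T := by
  refine hL.P2p_ext h2 fun X => ?_
  rw [s.decomp X]
  refine Subtype.ext ?_
  simp only [S.pMap_add_sSum, T.pMap_add_sSum, S.pMap_smul, T.pMap_smul, hx, ht, hH]

variable [hp : Fact p.Prime] [CharP K p]

/-- A `p|2p`-structure with prescribed values on `H`, the central element `x`, and `t`. -/
theorem SplitDecomp.exists_P2p (s : SplitDecomp K (gr 0) H) (hL : IsLieSuperalgebra gr br)
    (h2 : (2 : K) ≠ 0) (hodd : Odd p) (hx : br (s.x : A) = 0) (x' t' : gr 0) (h : H → gr 0)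
    (hx' : br (x' : A) = 0)
    (ht' : (br (t' : A) : Module.End K A) = (br (s.t : A) : Module.End K A) ^ p)
    (had : ∀ a, (br (h a : A) : Module.End K A) = (br (s.incl a : A) : Module.End K A) ^ p)
    (hsmul : ∀ (c : K) a, h (c • a) = c ^ p • h a)
    (hadd : ∀ a b, (h (a + b) : A) = h a + h b + sSum p br (s.incl a : A) (s.incl b : A)) :
    ∃ T : P2pStructure p gr br, (∀ a, T.pMap (s.incl a) = h a) ∧ T.pMap s.t = t' ∧
      T.pMap s.x = x' := by
  have hp0 : p ≠ 0 := hp.out.ne_zero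
  -- The value of `f` at `u x + a + v t` is forced by additivity up to the `s_i`. The only cross
  -- term is `q = ∑ s_i(a, v t)`, since `x` is central.
  let q (X : gr 0) : gr 0 := ⟨sSum p br (s.incl (s.proj X) : A) ((s.tCoord X • s.t : gr 0) : A),
    hL.sSum_mem h2 (Subtype.mem _) (Subtype.mem _)⟩
  let f (X : gr 0) : gr 0 :=
    s.xCoord X ^ p • x' + h (s.proj X) + s.tCoord X ^ p • t' + q X
  have hdec : ∀ X : gr 0, br (X : A) =
      br (s.incl (s.proj X) : A) + br ((s.tCoord X • s.t : gr 0) : A) := by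
    intro X
    nth_rewrite 1 [s.decomp X]
    simp [hx]
  have hx2 : ∀ (c : A), c ∈ gr 0 → br c (s.x : A) = 0 := by
    intro c hc
    rw [hL.skew_even hc, hx, LinearMap.zero_apply, neg_zero]
  -- The sum of the `s_i` depends only on the classes of its arguments modulo the central element
  -- `x`.
  have hss : ∀ X Y : gr 0, sSum p br (X : A) (Y : A) =
      sSum p br ((s.incl (s.proj X) : A) + ((s.tCoord X • s.t : gr 0) : A))
        ((s.incl (s.proj Y) : A) + ((s.tCoord Y • s.t : gr 0) : A)) := by
    intro X Y
    have hc : ∀ c : A, c ∈ gr 0 → br c X =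
        br c ((s.incl (s.proj X) : A) + ((s.tCoord X • s.t : gr 0) : A)) := by
      intro c hc
      nth_rewrite 1 [s.decomp X]
      simp [hx2 c hc]
    exact sSum_congr hp.out.two_le (by rw [hdec X, map_add]) (by rw [hdec Y, map_add])
      (hc _ X.2) (hc _ Y.2)
  have h0 : h 0 = 0 := by
    have := hsmul 0 0
    rwa [smul_zero, zero_pow hp0, zero_smul] at this
  have hq0 : ∀ X, s.tCoord X = 0 → q X = 0 := by
    intro X hX
    refine Subtype.ext ?_
    change sSum p br _ _ = 0
    rw [hX, zero_smul]
    exact sSum_eq_zero hp.out.two_le (hL.bracket_self_even h2 (Subtype.mem _)) (by simp)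
  have hq0' : ∀ X, s.proj X = 0 → q X = 0 := by
    intro X hX
    refine Subtype.ext ?_
    change sSum p br _ _ = 0
    rw [hX, map_zero]
    exact sSum_eq_zero hp.out.two_le (by simp) (by simp)
  refine ⟨hL.mkP2p f h2 ?_ ?_ ?_, ?_, ?_, ?_⟩
  · intro X
    have e : (br (X : A) : Module.End K A) ^ p =
        ((br (s.incl (s.proj X) : A) : Module.End K A) +
          (br ((s.tCoord X • s.t : gr 0) : A) : Module.End K A)) ^ p := by rw [hdec X]
    rw [e, hL.bracket_sSum h2 hodd (Subtype.mem _) (Subtype.mem _), ← had]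
    have e2 : (br ((s.tCoord X • s.t : gr 0) : A) : Module.End K A) ^ p =
        s.tCoord X ^ p • br (t' : A) := by
      rw [ht', Submodule.coe_smul, map_smul]
      exact smul_pow _ _ _
    rw [e2]
    simp [f, q, hx']
  · intro c X
    refine Subtype.ext ?_
    have e : (q (c • X) : A) = c ^ p • (q X : A) := by
      change sSum p br _ _ = c ^ p • sSum p br _ _
      rw [← sSum_smul hp0]
      simp [mul_smul]
    simp only [f, Submodule.coe_add, Submodule.coe_smul, map_smul, hsmul, smul_eq_mul, mul_pow, e,
      smul_add, smul_smul]
  · intro X Y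
    -- Regroup `(a + b) + (v t + w t)` as `(a + v t) + (b + w t)`; the two multiples of `t` commute,
    -- so their own term vanishes (`e0`).
    have e := hL.sSum_add_add (p := p) h2 hodd (Subtype.mem (s.incl (s.proj X)))
      (Subtype.mem (s.incl (s.proj Y))) (Subtype.mem (s.tCoord X • s.t))
      (Subtype.mem (s.tCoord Y • s.t))
    have e0 : sSum p br ((s.tCoord X • s.t : gr 0) : A) ((s.tCoord Y • s.t : gr 0) : A) = 0 := by
      refine sSum_eq_zero hp.out.two_le (hL.bracket_self_even h2 (Subtype.mem _)) ?_
      simp [hL.bracket_self_even h2 s.t.2]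
    rw [e0, add_zero, ← hss] at e
    have e1 : (q (X + Y) : A) = sSum p br ((s.incl (s.proj X) : A) + (s.incl (s.proj Y) : A))
        (((s.tCoord X • s.t : gr 0) : A) + ((s.tCoord Y • s.t : gr 0) : A)) := by
      simp [q, add_smul]
    have e2 : sSum p br (s.incl (s.proj X) : A) (s.incl (s.proj Y) : A) + (q (X + Y) : A) =
      q X + q Y + sSum p br (X : A) (Y : A) := by rw [e1, e]
    simp only [f, Submodule.coe_add, Submodule.coe_smul, map_add, hadd, add_pow_char, add_smul]
    linear_combination (norm := module) e2
  · intro a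
    change f _ = _
    simp only [f]
    rw [hq0 _ (s.tCoord_incl a), s.tCoord_incl, s.xCoord_incl, s.proj_incl, zero_pow hp0]
    simp
  · change f _ = _
    simp only [f]
    rw [hq0' _ s.proj_t, s.tCoord_t, s.xCoord_t, s.proj_t, zero_pow hp0, h0]
    simp
  · change f _ = _
    simp only [f]
    rw [hq0' _ s.proj_x, s.tCoord_x, s.xCoord_x, s.proj_x, zero_pow hp0, h0]
    simp

end SplitExtension

/-! ### Grading and form of `𝔤` -/

section ExtBasics

variable {K : Type*} [Field K] {A : Type*} [AddCommGroup A] [Module K A]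
  {gr : ZMod 2 → Submodule K A} {br : A →ₗ[K] A →ₗ[K] A} {B : A →ₗ[K] A →ₗ[K] K}
  {D : Module.End K A}

lemma zmod_two_cases (i : ZMod 2) : i = 0 ∨ i = 1 := by
  revert i
  decide

lemma mem_extGr {d i : ZMod 2} {f : DExt K A} :
    f ∈ extGr d gr i ↔ (i ≠ d → f.1 = 0) ∧ f.2.1 ∈ gr i ∧ (i ≠ d → f.2.2 = 0) := by
  by_cases h : i = d <;> simp [extGr, Submodule.mem_prod, h]

lemma zero_one_cover : (Set.univ : Set (ZMod 2)) = {0, 1} :=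
  (Set.eq_univ_of_forall zmod_two_cases).symm

lemma isInternal_extGr (d : ZMod 2) (h : DirectSum.IsInternal gr) :
    DirectSum.IsInternal (extGr d gr) := by
  rw [DirectSum.isInternal_submodule_iff_isCompl _ (i := 0) (j := 1) (by decide) zero_one_cover]
    at h ⊢
  constructor
  · rw [Submodule.disjoint_def]
    intro f hf hf'
    rw [mem_extGr] at hf hf'
    have h1 := Submodule.disjoint_def.1 h.disjoint _ hf.2.1 hf'.2.1
    rcases zmod_two_cases d with rfl | rfl
    · exact Prod.ext (hf'.1 (by decide)) (Prod.ext h1 (hf'.2.2 (by decide)))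
    · exact Prod.ext (hf.1 (by decide)) (Prod.ext h1 (hf.2.2 (by decide)))
  · rw [codisjoint_iff, Submodule.eq_top_iff']
    rintro ⟨u, a, v⟩
    obtain ⟨a₀, h₀, a₁, h₁, rfl⟩ :=
      Submodule.mem_sup.1 (h.sup_eq_top ▸ Submodule.mem_top : a ∈ gr 0 ⊔ gr 1)
    rw [Submodule.mem_sup]
    rcases zmod_two_cases d with rfl | rfl
    · exact ⟨(u, a₀, v), mem_extGr.2 (by simpa using h₀), (0, a₁, 0), mem_extGr.2 (by simpa using h₁),
        by simp⟩
    · exact ⟨(0, a₀, 0), mem_extGr.2 (by simpa using h₀), (u, a₁, v), mem_extGr.2 (by simpa using h₁),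
        by simp⟩

lemma extForm_apply (d : ZMod 2) (f g : DExt K A) :
    extForm d B f g = B f.2.1 g.2.1 + f.1 * g.2.2 + (-1 : K) ^ d.val * (f.2.2 * g.1) := rfl

lemma extForm_even (hB : IsEvenNIS gr br B) (d i j : ZMod 2) {f g : DExt K A}
    (hf : f ∈ extGr d gr i) (hg : g ∈ extGr d gr j) (hij : i ≠ j) : extForm d B f g = 0 := by
  rw [mem_extGr] at hf hg
  rw [extForm_apply, hB.even i j _ _ hf.2.1 hg.2.1 hij]
  by_cases hi : i = d
  · rw [hg.1 (hi ▸ hij.symm), hg.2.2 (hi ▸ hij.symm)]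
    simp
  · rw [hf.1 hi, hf.2.2 hi]
    simp

lemma extForm_symm (hB : IsEvenNIS gr br B) (d i j : ZMod 2) {f g : DExt K A}
    (hf : f ∈ extGr d gr i) (hg : g ∈ extGr d gr j) :
    extForm d B g f = (-1 : K) ^ (i.val * j.val) * extForm d B f g := by
  rw [mem_extGr] at hf hg
  rw [extForm_apply, extForm_apply, hB.symm i j _ _ hf.2.1 hg.2.1]
  by_cases hi : i = d
  · by_cases hj : j = d
    · subst hi
      subst hj
      rcases zmod_two_cases j with rfl | rfl
      · simp; ring
      · simp [ZMod.val_one]; ring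
    · rw [hg.1 hj, hg.2.2 hj]
      simp
  · rw [hf.1 hi, hf.2.2 hi]
    simp

lemma extForm_nondegenerate (hB : B.Nondegenerate) (d : ZMod 2) :
    (extForm d B : DExt K A →ₗ[K] DExt K A →ₗ[K] K).Nondegenerate := by
  constructor
  · intro f hf
    have h1 := hf (1, 0, 0)
    have h2 := hf (0, 0, 1)
    have h3 : ∀ b, B f.2.1 b = 0 := fun b => by simpa [extForm_apply] using hf (0, b, 0)
    simp [extForm_apply] at h1 h2
    exact Prod.ext h2 (Prod.ext (hB.1 _ h3) h1)
  · intro f hf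
    have h1 := hf (1, 0, 0)
    have h2 := hf (0, 0, 1)
    have h3 : ∀ b, B b f.2.1 = 0 := fun b => by simpa [extForm_apply] using hf (0, b, 0)
    simp [extForm_apply] at h1 h2
    exact Prod.ext h2 (Prod.ext (hB.2 _ h3) h1)

/-- An even operator `ad_a` is skew with respect to an invariant form. -/
lemma form_ad_pow (hL : IsLieSuperalgebra gr br) (hB : IsEvenNIS gr br B) {a : A} (ha : a ∈ gr 0)
    (n : ℕ) (b c : A) :
    B (((br a : Module.End K A) ^ n) b) c = (-1 : K) ^ n * B b (((br a : Module.End K A) ^ n) c) := by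
  induction n generalizing b with
  | zero => simp
  | succ n ih =>
    rw [pow_succ, Module.End.mul_apply, ih, hL.skew_even ha b, map_neg, LinearMap.neg_apply,
      hB.invariant, ← Module.End.mul_apply, ← pow_succ', ← pow_succ, pow_succ (-1 : K)]
    ring

lemma ad_pow_mem (hL : IsLieSuperalgebra gr br) {a c : A} (ha : a ∈ gr 0) {i : ZMod 2}
    (hc : c ∈ gr i) (n : ℕ) : ((br a : Module.End K A) ^ n) c ∈ gr i := by
  induction n with
  | zero => simpa
  | succ n ih =>
    rw [pow_succ', Module.End.mul_apply]
    simpa using hL.bracket_mem 0 i a _ ha ih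

end ExtBasics

/-! ### Even `D`: bracket and invariant form -/

section EvenExt

variable {K : Type*} [Field K] {A : Type*} [AddCommGroup A] [Module K A]
  {gr : ZMod 2 → Submodule K A} {br : A →ₗ[K] A →ₗ[K] A} {B : A →ₗ[K] A →ₗ[K] K}
  {D : Module.End K A}

lemma evenExtBr_apply (f g : DExt K A) :
    evenExtBr br B D f g =
      (B (D f.2.1) g.2.1, br f.2.1 g.2.1 + f.2.2 • D g.2.1 - g.2.2 • D f.2.1, 0) := rfl

lemma IsDInvariant.apply_even (hinv : IsDInvariant gr B 0 D) (hL : IsLieSuperalgebra gr br)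
    (a b : A) : B (D a) b = -B a (D b) := by
  obtain ⟨a₀, h₀, a₁, h₁, rfl⟩ := hL.exists_even_add_odd a
  have e0 := hinv 0 a₀ b h₀
  have e1 := hinv 1 a₁ b h₁
  simp at e0 e1
  simp only [map_add, LinearMap.add_apply]
  linear_combination e0 + e1

lemma IsSuperDerivation.leibniz_even (hD : IsSuperDerivation gr br 0 D)
    (hL : IsLieSuperalgebra gr br) (a b : A) : D (br a b) = br (D a) b + br a (D b) := by
  obtain ⟨a₀, h₀, a₁, h₁, rfl⟩ := hL.exists_even_add_odd a
  have e0 := hD.leibniz 0 a₀ b h₀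
  have e1 := hD.leibniz 1 a₁ b h₁
  simp at e0 e1
  simp only [map_add, LinearMap.add_apply, e0, e1]
  abel

/-- For an even derivation, the sign of a pair of homogeneous elements of `𝔤` is trivial or the
elements are odd elements of `𝔞`. -/
lemma sign_cases {i j : ZMod 2} {f g : DExt K A} (hf : f ∈ extGr 0 gr i) (hg : g ∈ extGr 0 gr j) :
    (-1 : K) ^ (i.val * j.val) = 1 ∨
      ((-1 : K) ^ (i.val * j.val) = -1 ∧ f.2.2 = 0 ∧ g.2.2 = 0) := by
  rw [mem_extGr] at hf hg
  rcases zmod_two_cases i with rfl | rfl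
  · left; simp
  · rcases zmod_two_cases j with rfl | rfl
    · left; simp
    · right
      exact ⟨by simp [ZMod.val_one], hf.2.2 (by decide), hg.2.2 (by decide)⟩

/-- `B(D a, b)` is super-antisymmetric by `D`-invariance, and a cocycle by the Leibniz rule and the
invariance of `B`. For the triple bracket of an odd `a`, its value on `a` and `[a,a]` vanishes by
parity, so characteristic `3` needs no extra condition. -/
theorem isLieSuperalgebra_evenExt (hL : IsLieSuperalgebra gr br) (hB : IsEvenNIS gr br B)
    (hD : IsSuperDerivation gr br 0 D) (hinv : IsDInvariant gr B 0 D) :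
    IsLieSuperalgebra (extGr 0 gr) (evenExtBr br B D) where
  isInternal := isInternal_extGr 0 hL.isInternal
  bracket_mem i j f g hf hg := by
    rw [mem_extGr] at hf hg ⊢
    have hDf : D f.2.1 ∈ gr i := by simpa using hD.map_mem i _ hf.2.1
    have hDg : D g.2.1 ∈ gr j := by simpa using hD.map_mem j _ hg.2.1
    refine ⟨fun hij => hB.even i j _ _ hDf hg.2.1 ?_, ?_, fun _ => rfl⟩
    · rintro rfl
      exact hij (CharTwo.add_self_eq_zero i)
    · refine sub_mem (add_mem (hL.bracket_mem i j _ _ hf.2.1 hg.2.1) ?_) ?_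
      · by_cases hi : i = 0
        · subst hi
          rw [zero_add]
          exact Submodule.smul_mem _ _ hDg
        · rw [hf.2.2 hi, zero_smul]
          exact zero_mem _
      · by_cases hj : j = 0
        · subst hj
          rw [add_zero]
          exact Submodule.smul_mem _ _ hDf
        · rw [hg.2.2 hj, zero_smul]
          exact zero_mem _
  skew i j f g hf hg := by
    have hs := sign_cases hf hg
    rw [mem_extGr] at hf hg
    have hDg : D g.2.1 ∈ gr j := by simpa using hD.map_mem j _ hg.2.1
    have e1 := hL.skew i j _ _ hf.2.1 hg.2.1
    have e2 := hB.symm i j _ _ hf.2.1 hDg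
    have e3 := hinv.apply_even hL f.2.1 g.2.1
    rw [evenExtBr_apply, evenExtBr_apply]
    refine Prod.ext ?_ (Prod.ext ?_ ?_)
    · simp only [Prod.fst_neg, Prod.smul_fst, smul_eq_mul]
      rcases hs with hs | ⟨hs, -, -⟩ <;> rw [hs] at e2 ⊢ <;> rw [e2, e3] <;> ring
    · simp only [Prod.snd_neg, Prod.fst_neg, Prod.smul_snd, Prod.smul_fst]
      rcases hs with hs | ⟨hs, h1, h2⟩
      · rw [hs] at e1 ⊢
        rw [e1]
        module
      · rw [hs] at e1 ⊢
        rw [e1, h1, h2]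
        module
    · simp
  jacobi i j k f g h hf hg hh := by
    have hs := sign_cases hf hg
    rw [mem_extGr] at hf hg hh
    have hDf : D f.2.1 ∈ gr i := by simpa using hD.map_mem i _ hf.2.1
    have hDg : D g.2.1 ∈ gr j := by simpa using hD.map_mem j _ hg.2.1
    have e1 := hL.jacobi i j k _ _ _ hf.2.1 hg.2.1 hh.2.1
    have e2 := hL.skew i j _ _ hf.2.1 hDg
    have e2' := hL.skew i j _ _ hDf hg.2.1
    have e3 := hB.symm i j _ _ hDf hDg
    have e4 := hinv.apply_even hL
    have e5 := hD.leibniz_even hL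
    simp only [evenExtBr_apply]
    refine Prod.ext ?_ (Prod.ext ?_ ?_)
    · simp only [Prod.fst_add, Prod.smul_fst, smul_eq_mul, map_add, map_sub, map_smul,
        LinearMap.add_apply, LinearMap.sub_apply, LinearMap.smul_apply, e5, hB.invariant]
      have i1 := hB.invariant f.2.1 (D g.2.1) h.2.1
      have i2 := hB.invariant (D g.2.1) f.2.1 h.2.1
      have e7 := e4 (D f.2.1) h.2.1
      have e8 := e4 (D g.2.1) h.2.1
      rcases hs with hs | ⟨hs, h1, h2⟩
      · rw [hs] at e2 e3 ⊢
        rw [← i1, ← i2, e2]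
        simp only [map_neg, LinearMap.neg_apply, map_smul, LinearMap.smul_apply, smul_eq_mul]
        linear_combination g.2.2 * e7 - f.2.2 * e8 + h.2.2 * e3
      · rw [hs] at e2 e3 ⊢
        rw [← i1, ← i2, e2, h1, h2]
        simp only [map_neg, LinearMap.neg_apply, map_smul, LinearMap.smul_apply, smul_eq_mul]
        linear_combination -h.2.2 * e3
    · simp only [Prod.snd_add, Prod.fst_add, Prod.smul_snd, Prod.smul_fst, map_add, map_sub,
        map_smul, LinearMap.add_apply, LinearMap.sub_apply, LinearMap.smul_apply, e5]
      rcases hs with hs | ⟨hs, h1, h2⟩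
      · rw [hs] at e1 e2 e2' ⊢
        rw [e1, e2']
        module
      · rw [hs] at e1 e2 e2' ⊢
        rw [e1, e2', h1, h2]
        module
    · simp
  odd_triple f hf := by
    rw [mem_extGr] at hf
    have h1 : f.2.2 = 0 := hf.2.2 (by decide)
    have hDf : D f.2.1 ∈ gr 1 := by simpa using hD.map_mem 1 _ hf.2.1
    have h2 := hB.even 1 0 _ _ hDf (hL.bracket_mem 1 1 _ _ hf.2.1 hf.2.1) (by decide)
    simp only [evenExtBr_apply, h1, zero_smul, add_zero, sub_zero, h2, hL.odd_triple _ hf.2.1]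
    rfl

theorem isEvenNIS_evenExt (hL : IsLieSuperalgebra gr br) (hB : IsEvenNIS gr br B)
    (hinv : IsDInvariant gr B 0 D) :
    IsEvenNIS (extGr 0 gr) (evenExtBr br B D) (extForm 0 B) where
  even i j _ _ hf hg hij := extForm_even hB 0 i j hf hg hij
  symm i j _ _ hf hg := extForm_symm hB 0 i j hf hg
  invariant f g h := by
    have e1 := hinv.apply_even hL f.2.1 h.2.1
    have e2 := hinv.apply_even hL f.2.1 g.2.1
    simp only [evenExtBr_apply, extForm_apply, map_add, map_sub, map_smul, LinearMap.add_apply,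
      LinearMap.sub_apply, LinearMap.smul_apply, smul_eq_mul, hB.invariant, e1, e2, ZMod.val_zero,
      pow_zero]
    ring
  nondegenerate := extForm_nondegenerate hB.nondegenerate 0

end EvenExt

/-! ### Even `D`: the `p|2p`-structure -/

section EvenPStructure

variable {K : Type*} [Field K] {A : Type*} [AddCommGroup A] [Module K A]
  {gr : ZMod 2 → Submodule K A} {br : A →ₗ[K] A →ₗ[K] A} {B : A →ₗ[K] A →ₗ[K] K}
  {D : Module.End K A}

/-- The even part of `𝔤`, when `x` and `x*` are even, as `K x ⊕ 𝔞_0 ⊕ K x*`. -/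
def evenSplit (gr : ZMod 2 → Submodule K A) : SplitDecomp K (extGr 0 gr 0) (gr 0) where
  x := xEven gr
  t := xStarEven gr
  incl :=
    { toFun := inclEven 0 gr
      map_add' := fun a b => Subtype.ext (by simp [inclEven])
      map_smul' := fun c a => Subtype.ext (by simp [inclEven]) }
  xCoord :=
    { toFun := fun X => (X : DExt K A).1
      map_add' := fun _ _ => rfl
      map_smul' := fun _ _ => rfl }
  proj :=
    { toFun := fun X => ⟨(X : DExt K A).2.1, (mem_extGr.1 X.2).2.1⟩
      map_add' := fun _ _ => rfl
      map_smul' := fun _ _ => rfl }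
  tCoord :=
    { toFun := fun X => (X : DExt K A).2.2
      map_add' := fun _ _ => rfl
      map_smul' := fun _ _ => rfl }
  decomp X := Subtype.ext (by simp [inclEven, xEven, xStarEven])
  xCoord_x := rfl
  proj_x := rfl
  tCoord_x := rfl
  xCoord_t := rfl
  proj_t := rfl
  tCoord_t := rfl
  xCoord_incl _ := rfl
  proj_incl _ := rfl
  tCoord_incl _ := rfl

@[simp] lemma evenSplit_incl (a : gr 0) : (evenSplit gr).incl a = inclEven 0 gr a := rfl

@[simp] lemma coe_inclEven (d : ZMod 2) (a : gr 0) :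
    (inclEven d gr a : DExt K A) = (0, (a : A), 0) := rfl

lemma coeff_sigmaPoly_zero {p : ℕ} (hp : 2 ≤ p) (a b : A) :
    (sigmaPoly p br B D a b).coeff 0 = B (D b) (((adLam br a b ^ (p - 2)).coeff 0) a) := by
  rw [sigmaPoly, Polynomial.finsetSum_coeff, sum_eq_single 0]
  · simp
  · intro j _ hj
    rw [Polynomial.coeff_mul_X_pow', if_neg (by omega)]
  · intro h
    exact absurd (mem_range.2 (by omega)) h

lemma coeff_sigmaPoly_succ {p i : ℕ} (hi : i + 1 < p - 1) (a b : A) :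
    (sigmaPoly p br B D a b).coeff (i + 1) = B (D a) (((adLam br a b ^ (p - 2)).coeff i) a) +
      B (D b) (((adLam br a b ^ (p - 2)).coeff (i + 1)) a) := by
  rw [sigmaPoly, Polynomial.finsetSum_coeff,
    ← sum_subset (s₁ := {i, i + 1}), sum_pair (by omega)]
  · rw [Polynomial.coeff_mul_X_pow', if_pos (by omega), Polynomial.coeff_mul_X_pow',
      if_pos le_rfl, Nat.sub_self, Nat.add_sub_cancel_left]
    simp [Polynomial.coeff_C]
  · intro j hj
    simp only [mem_insert, mem_singleton] at hj
    exact mem_range.2 (by omega)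
  · intro j hj hj'
    simp only [mem_insert, mem_singleton, not_or] at hj'
    rw [Polynomial.coeff_mul_X_pow']
    split_ifs with h
    · obtain ⟨k, hk⟩ : ∃ k, i + 1 - j = k + 2 := ⟨i + 1 - j - 2, by omega⟩
      rw [hk]
      simp
    · rfl

lemma snd_coeff_adLam_evenExtBr (a b c : A) (n i : ℕ) :
    (((adLam (evenExtBr br B D) (0, a, 0) (0, b, 0) ^ n).coeff i) (0, c, 0)).2 =
      (((adLam br a b ^ n).coeff i) c, 0) := by
  induction n generalizing i with
  | zero =>
    rw [coeff_adLam_pow_zero, coeff_adLam_pow_zero]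
    split_ifs <;> rfl
  | succ n ih =>
    rcases i with _ | i
    · rw [coeff_adLam_pow_succ_zero, coeff_adLam_pow_succ_zero, evenExtBr_apply, ih]
      simp
    · rw [coeff_adLam_pow_succ_succ, coeff_adLam_pow_succ_succ, evenExtBr_apply, evenExtBr_apply,
        ih, ih]
      simp

/-- As `x` is central, only the outermost bracket of `(ad_{λa+b})^{p-1}(a)` contributes an
`x`-coordinate, namely `B(D(λa+b), (ad_{λa+b})^{p-2}(a))`. -/
lemma sSum_evenExtBr {p : ℕ} (hp : 2 ≤ p) (a b : A) :
    sSum p (evenExtBr br B D) (0, a, 0) (0, b, 0) =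
      (∑ i ∈ Icc 1 (p - 1), sigmaCoeff p br B D a b i, sSum p br a b, 0) := by
  have h1 : ∀ i ∈ Icc 1 (p - 1), sCoeff p (evenExtBr br B D) (0, a, 0) (0, b, 0) i =
      (sigmaCoeff p br B D a b i, sCoeff p br a b i, 0) := by
    intro i hi
    have hi' := mem_Icc.1 hi
    rw [sCoeff, sCoeff, sigmaCoeff]
    refine Prod.ext ?_ ?_
    · rw [Prod.smul_fst, smul_eq_mul]
      congr 1
      rw [show p - 1 = p - 2 + 1 by omega]
      rcases hk : i - 1 with _ | k
      · rw [coeff_adLam_pow_succ_zero, evenExtBr_apply, snd_coeff_adLam_evenExtBr,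
          coeff_sigmaPoly_zero hp]
      · rw [coeff_adLam_pow_succ_succ, evenExtBr_apply, evenExtBr_apply,
          snd_coeff_adLam_evenExtBr, snd_coeff_adLam_evenExtBr, coeff_sigmaPoly_succ (by omega)]
        rfl
    · rw [Prod.smul_snd, snd_coeff_adLam_evenExtBr]
      simp
  rw [sSum, sum_congr rfl h1, sSum]
  refine Prod.ext ?_ (Prod.ext ?_ ?_)
  · rw [Prod.fst_sum]
  · rw [Prod.snd_sum, Prod.fst_sum]
  · rw [Prod.snd_sum, Prod.snd_sum]
    simp

lemma evenExtBr_pow_succ (u : K) (a c : A) (w : K) (n : ℕ) :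
    ((evenExtBr br B D (u, a, 0) : Module.End K (DExt K A)) ^ (n + 1)) (w, c, 0) =
      (B (D a) (((br a : Module.End K A) ^ n) c), ((br a : Module.End K A) ^ (n + 1)) c, 0) := by
  induction n with
  | zero => simp [evenExtBr_apply]
  | succ n ih =>
    rw [pow_succ' _ (n + 1), Module.End.mul_apply, ih, evenExtBr_apply]
    simp [pow_succ']

lemma evenExtBr_xStar_pow (u w v : K) (c : A) (n : ℕ) :
    ((evenExtBr br B D (u, 0, 1) : Module.End K (DExt K A)) ^ (n + 1)) (w, c, v) =
      (0, (D ^ (n + 1)) c, 0) := by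
  induction n with
  | zero => simp [evenExtBr_apply]
  | succ n ih =>
    rw [pow_succ' _ (n + 1), Module.End.mul_apply, ih, evenExtBr_apply]
    simp [pow_succ']

/-- On `𝔞` the `x`-coordinates agree because `D` is restricted and `(ad_a)^{p-1}` is self-adjoint,
`p - 1` being even. On `x*` restrictedness gives the `𝔞`-component, and the `x`-coordinate vanishes
by `hz`. The parameters `u`, `w` are free because `x` is central. -/
lemma evenExtBr_pMap {p : ℕ} [hp : Fact p.Prime] (hodd : Odd p) (h2 : (2 : K) ≠ 0)
    (hL : IsLieSuperalgebra gr br)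
    (hB : IsEvenNIS gr br B) (S : P2pStructure p gr br) (hres : IsRestrictedDer S D)
    (hD : IsSuperDerivation gr br 0 D) (a : gr 0) (u w : K) :
    (evenExtBr br B D (u, (S.pMap a : A), 0) : Module.End K (DExt K A)) =
      (evenExtBr br B D (w, (a : A), 0) : Module.End K (DExt K A)) ^ p := by
  have hp2 := hp.out.two_le
  have hDa : D (a : A) ∈ gr 0 := by simpa using hD.map_mem 0 _ a.2
  obtain ⟨n, rfl⟩ : ∃ n, p = n + 2 := ⟨p - 2, by omega⟩
  have hn : Odd n := by
    rw [Nat.odd_add] at hodd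
    exact hodd.2 (by decide)
  have hr : D (S.pMap a : A) = ((br (a : A) : Module.End K A) ^ (n + 1)) (D (a : A)) := hres a
  -- `(ad_a)^{p-2}` is skew-adjoint since `p - 2` is odd, whereas `B` is symmetric on the even
  -- element `D a`.
  have hz : B (D (a : A)) (((br (a : A) : Module.End K A) ^ n) (D (a : A))) = 0 := by
    have e1 := form_ad_pow hL hB a.2 n (D (a : A)) (D (a : A))
    have e2 := hB.symm 0 0 _ _ hDa (ad_pow_mem hL a.2 hDa n)
    rw [hn.neg_one_pow] at e1
    simp only [ZMod.val_zero, mul_zero, pow_zero, one_mul] at e2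
    rw [e2] at e1
    refine (mul_eq_zero.1 (?_ : (2 : K) * _ = 0)).resolve_left h2
    linear_combination e1
  refine LinearMap.ext fun f => ?_
  obtain ⟨y, c, v⟩ := f
  have hsplit : ((y, c, v) : DExt K A) = (y, c, 0) + v • (0, 0, 1) := by simp
  have h1 : ((evenExtBr br B D (w, (a : A), 0) : Module.End K (DExt K A)) ^ (n + 2)) (0, 0, 1) =
      (0, -((br (a : A) : Module.End K A) ^ (n + 1)) (D (a : A)), 0) := by
    rw [pow_succ, Module.End.mul_apply]
    have : (evenExtBr br B D (w, (a : A), 0)) (0, 0, 1) = (0, -D (a : A), 0) := by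
      simp [evenExtBr_apply]
    rw [this, evenExtBr_pow_succ, map_neg, map_neg, map_neg, hz, neg_zero]
  rw [hsplit, map_add, map_add, map_smul, map_smul, h1, evenExtBr_pow_succ, evenExtBr_apply,
    evenExtBr_apply, S.ad_pMap, hr, form_ad_pow hL hB a.2, hn.add_one.neg_one_pow, one_mul]
  simp

theorem existsUnique_P2p_evenExt {p : ℕ} [hp : Fact p.Prime] [CharP K p] (hodd : Odd p)
    (hL : IsLieSuperalgebra gr br) (hB : IsEvenNIS gr br B) (h2 : (2 : K) ≠ 0)
    (S : P2pStructure p gr br) (hres : IsRestrictedDer S D)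
    (hD : IsSuperDerivation gr br 0 D) (hinv : IsDInvariant gr B 0 D)
    (γ : K) (a₀ : gr 0) (hDp : D ^ p = γ • D + br (a₀ : A)) (ha₀ : D (a₀ : A) = 0)
    (m l : K) (c₀ : gr 0) (hc : ∀ a : A, br (c₀ : A) a = 0) (hDc : D (c₀ : A) = 0)
    (P : gr 0 → K) (hPs : ∀ (c : K) (a : gr 0), P (c • a) = c ^ p * P a)
    (hPa : ∀ a b : gr 0, P (a + b) - P a - P b =
        ∑ i ∈ Icc 1 (p - 1), sigmaCoeff p br B D (a : A) (b : A) i) :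
    ∃! T : P2pStructure p (extGr 0 gr) (evenExtBr br B D),
      (∀ a : gr 0, T.pMap (inclEven 0 gr a) = inclEven 0 gr (S.pMap a) + P a • xEven gr) ∧
      T.pMap (xStarEven gr) = inclEven 0 gr a₀ + l • xEven gr + γ • xStarEven gr ∧
      T.pMap (xEven gr) = m • xEven gr + inclEven 0 gr c₀ := by
  have hLG := isLieSuperalgebra_evenExt hL hB hD hinv
  have hp2 := hp.out.two_le
  obtain ⟨T, hT⟩ := (evenSplit gr).exists_P2p (p := p) hLG h2 hodd
    (by refine LinearMap.ext fun f => ?_; simp [evenSplit, xEven, evenExtBr_apply])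
    (m • xEven gr + inclEven 0 gr c₀) (inclEven 0 gr a₀ + l • xEven gr + γ • xStarEven gr)
    (fun a => inclEven 0 gr (S.pMap a) + P a • xEven gr)
    (by
      refine LinearMap.ext fun f => ?_
      simp [xEven, evenExtBr_apply, hc, hDc])
    (by
      refine LinearMap.ext fun f => ?_
      obtain ⟨n, rfl⟩ : ∃ n, p = n + 1 := ⟨p - 1, by omega⟩
      obtain ⟨y, c, v⟩ := f
      change _ = ((evenExtBr br B D (0, 0, 1) : Module.End K (DExt K A)) ^ (n + 1)) (y, c, v)
      -- The `p`-th power of `ad_{x*}` acts on `𝔞` as `D^p = γ D + ad_{a₀}` and kills `x` and `x*`;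
      -- `D a₀ = 0` removes the unwanted components of `ad_{a₀}` in `𝔤`.
      rw [evenExtBr_xStar_pow, hDp]
      simp [xEven, xStarEven, evenExtBr_apply, ha₀, add_comm])
    (by
      intro a
      have := evenExtBr_pMap hodd h2 hL hB S hres hD a (P a) 0
      rw [evenSplit_incl, coe_inclEven, ← this]
      congr 1
      simp [xEven])
    (by
      intro c a
      rw [S.pMap_smul, hPs, smul_add, smul_smul]
      congr 1
      exact Subtype.ext (by simp))
    (by
      intro a b
      have h := hPa a b
      -- The `x`-coordinate of the additivity rule is precisely the hypothesis on `P`.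
      rw [evenSplit_incl, evenSplit_incl, coe_inclEven, coe_inclEven, sSum_evenExtBr hp2, ← h]
      simp [xEven, S.pMap_add_sSum])
  refine ⟨T, hT, fun T' hT' => (evenSplit gr).P2p_ext hLG h2 (hT'.2.2.trans hT.2.2.symm)
    (hT'.2.1.trans hT.2.1.symm) fun a => (hT'.1 a).trans (hT.1 a).symm⟩

end EvenPStructure

/-! ### Odd `D`: bracket and invariant form -/

section OddExt

variable {K : Type*} [Field K] {A : Type*} [AddCommGroup A] [Module K A]
  {gr : ZMod 2 → Submodule K A} {br : A →ₗ[K] A →ₗ[K] A}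
  {B : A →ₗ[K] A →ₗ[K] K} {D : Module.End K A} {b₀ : A}

lemma IsEvenNIS.form_comm_even (hB : IsEvenNIS gr br B) (hL : IsLieSuperalgebra gr br)
    (hb : b₀ ∈ gr 0) (y : A) : B y b₀ = B b₀ y := by
  obtain ⟨y₀, h₀, y₁, h₁, rfl⟩ := hL.exists_even_add_odd y
  have e0 := hB.symm 0 0 _ _ hb h₀
  have e1 := hB.symm 0 1 _ _ hb h₁
  simp at e0 e1
  simp only [map_add, LinearMap.add_apply, e0, e1]

lemma IsDInvariant.form_map_eq_zero {d : ZMod 2} (hinv : IsDInvariant gr B d D)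
    (hL : IsLieSuperalgebra gr br) (hD0 : D b₀ = 0) (y : A) : B (D y) b₀ = 0 := by
  obtain ⟨y₀, h₀, y₁, h₁, rfl⟩ := hL.exists_even_add_odd y
  have e0 := hinv 0 y₀ b₀ h₀
  have e1 := hinv 1 y₁ b₀ h₁
  simp [hD0] at e0 e1
  simp only [map_add, LinearMap.add_apply, e0, e1, add_zero]

/-- Moving `D` across the form leaves `B(D² a, b) = B([b₀,a], b) = B(b₀, [a,b])` up to sign. In the
Jacobi identity for `x*, a, b` two such terms match the factor `2` in `[x*,a]`. -/
lemma IsDInvariant.form_map_map (hinv : IsDInvariant gr B 1 D) (hB : IsEvenNIS gr br B)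
    (hD : IsSuperDerivation gr br 1 D) (hD2 : D ^ 2 = br b₀) {i : ZMod 2} {a : A}
    (ha : a ∈ gr i) (b : A) : B (D a) (D b) = (-1 : K) ^ i.val * B b₀ (br a b) := by
  have e := hinv (i + 1) (D a) b (hD.map_mem i a ha)
  have e2 : D (D a) = br b₀ a := by rw [← hD2, pow_two, Module.End.mul_apply]
  rw [e2, hB.invariant] at e
  rcases zmod_two_cases i with rfl | rfl
  · simp [ZMod.val_one] at e ⊢
    linear_combination -e
  · simp [ZMod.val_one, show (1 : ZMod 2) + 1 = 0 by decide] at e ⊢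
    linear_combination e

/-- For odd `D` the form `B(D a, b)` lives on pairs of opposite parity, where super-antisymmetry is
ordinary antisymmetry. -/
lemma IsDInvariant.form_map_skew (hinv : IsDInvariant gr B 1 D) (hB : IsEvenNIS gr br B)
    (hD : IsSuperDerivation gr br 1 D) {i j : ZMod 2} {a b : A} (ha : a ∈ gr i) (hb : b ∈ gr j) :
    B (D b) a = -B (D a) b := by
  have hDa := hD.map_mem i a ha
  have hDb := hD.map_mem j b hb
  have e := hinv j b a hb
  have e2 := hB.symm (i + 1) j _ _ hDa hb
  by_cases h : i + 1 = j
  · subst h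
    rw [e2] at e
    rcases zmod_two_cases i with rfl | rfl
    · simp [ZMod.val_one] at e
      linear_combination e
    · simp [ZMod.val_one, show (1 : ZMod 2) + 1 = 0 by decide] at e
      linear_combination e
  · rw [hB.even _ _ _ _ hDa hb h, hB.even _ _ _ _ hDb ha, neg_zero]
    rintro rfl
    apply h
    rw [add_assoc, CharTwo.add_self_eq_zero, add_zero]

/-- Here `x` and `x*` are odd, so the even part of `𝔤` is just `𝔞_0`. -/
lemma eq_inclEven (X : extGr 1 gr 0) :
    X = inclEven 1 gr ⟨(X : DExt K A).2.1, (mem_extGr.1 X.2).2.1⟩ := by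
  obtain ⟨h1, -, h3⟩ := mem_extGr.1 X.2
  exact Subtype.ext (Prod.ext (h1 (by decide)) (Prod.ext rfl (h3 (by decide))))

/-- The Leibniz rule gives `D[a,a] = 2[D a, a]`. Pairing with `a` and using both invariances yields
`3 B(D a, [a,a]) = 0`, which is why characteristic `3` needs a separate hypothesis. -/
lemma form_map_bracket_self (hL : IsLieSuperalgebra gr br) (hB : IsEvenNIS gr br B)
    (hD : IsSuperDerivation gr br 1 D) (hinv : IsDInvariant gr B 1 D) (h3 : (3 : K) ≠ 0) {a : A}
    (ha : a ∈ gr 1) : B (D a) (br a a) = 0 := by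
  have hDa : D a ∈ gr 0 := hD.map_mem 1 _ ha
  have haa : br a a ∈ gr 0 := hL.bracket_mem 1 1 _ _ ha ha
  have l := hD.leibniz 1 a a ha
  have s := hL.skew_even hDa a
  have i1 := hinv 0 (br a a) a haa
  have i2 := hB.invariant (D a) a a
  have i3 := hB.symm 0 0 _ _ haa hDa
  simp only [ZMod.val_one, mul_one, pow_one, neg_smul, one_smul] at l
  rw [← neg_eq_iff_eq_neg.2 s] at l
  simp only [ZMod.val_zero, mul_zero, pow_zero, one_mul, l, map_neg,
    LinearMap.neg_apply, LinearMap.add_apply, map_add, i2] at i1 i3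
  refine (mul_eq_zero.1 (?_ : (3 : K) * _ = 0)).resolve_left h3
  linear_combination i1 + i3

variable [DirectSum.Decomposition gr]

lemma parityInv_of_mem {i : ZMod 2} {a : A} (ha : a ∈ gr i) :
    parityInv gr a = (-1 : K) ^ i.val • a := by
  change (DirectSum.decompose gr a 0 : A) - (DirectSum.decompose gr a 1 : A) = _
  rcases zmod_two_cases i with rfl | rfl
  · rw [DirectSum.decompose_of_mem_same gr ha,
      DirectSum.decompose_of_mem_ne gr ha (by decide : (0 : ZMod 2) ≠ 1)]
    simp
  · rw [DirectSum.decompose_of_mem_same gr ha,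
      DirectSum.decompose_of_mem_ne gr ha (by decide : (1 : ZMod 2) ≠ 0)]
    simp [ZMod.val_one]

lemma oddExtBr_apply (f g : DExt K A) :
    oddExtBr gr br B D b₀ f g =
      (-B (D f.2.1) g.2.1 - 2 * f.2.2 * B g.2.1 b₀ + 2 * g.2.2 * B f.2.1 b₀,
        br f.2.1 g.2.1 + f.2.2 • D g.2.1 - g.2.2 • D (parityInv gr f.2.1)
          + (2 * f.2.2 * g.2.2) • b₀,
        0) := rfl

lemma oddExtBr_mem (hL : IsLieSuperalgebra gr br) (hB : IsEvenNIS gr br B)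
    (hD : IsSuperDerivation gr br 1 D) (hb : b₀ ∈ gr 0) {i j : ZMod 2} {f g : DExt K A}
    (hf : f ∈ extGr 1 gr i) (hg : g ∈ extGr 1 gr j) :
    oddExtBr gr br B D b₀ f g ∈ extGr 1 gr (i + j) := by
  rw [mem_extGr] at hf hg ⊢
  have hDf := hD.map_mem i _ hf.2.1
  have hDg := hD.map_mem j _ hg.2.1
  rw [oddExtBr_apply, parityInv_of_mem hf.2.1]
  refine ⟨fun hij => ?_, ?_, fun _ => rfl⟩
  · have e1 : B (D f.2.1) g.2.1 = 0 := by
      refine hB.even _ _ _ _ hDf hg.2.1 ?_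
      rintro rfl
      exact hij (by rw [← add_assoc, CharTwo.add_self_eq_zero, zero_add])
    have e2 : f.2.2 * B g.2.1 b₀ = 0 := by
      by_cases hi : i = 1
      · subst hi
        rw [hB.even j 0 _ _ hg.2.1 hb (by rintro rfl; exact hij (add_zero _)), mul_zero]
      · rw [hf.2.2 hi, zero_mul]
    have e3 : g.2.2 * B f.2.1 b₀ = 0 := by
      by_cases hj : j = 1
      · subst hj
        rw [hB.even i 0 _ _ hf.2.1 hb (by rintro rfl; exact hij (zero_add _)), mul_zero]
      · rw [hg.2.2 hj, zero_mul]
    linear_combination -e1 - 2 * e2 + 2 * e3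
  · refine add_mem (sub_mem (add_mem (hL.bracket_mem i j _ _ hf.2.1 hg.2.1) ?_) ?_) ?_
    · by_cases hi : i = 1
      · subst hi
        rw [add_comm (1 : ZMod 2) j]
        exact Submodule.smul_mem _ _ hDg
      · rw [hf.2.2 hi, zero_smul]
        exact zero_mem _
    · by_cases hj : j = 1
      · subst hj
        rw [map_smul]
        exact Submodule.smul_mem _ _ (Submodule.smul_mem _ _ hDf)
      · rw [hg.2.2 hj, zero_smul]
        exact zero_mem _
    · by_cases hi : i = 1
      · by_cases hj : j = 1
        · subst hi
          subst hj
          rw [show (1 : ZMod 2) + 1 = 0 by decide]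
          exact Submodule.smul_mem _ _ hb
        · rw [hg.2.2 hj, mul_zero, zero_smul]
          exact zero_mem _
      · rw [hf.2.2 hi, mul_zero, zero_mul, zero_smul]
        exact zero_mem _

/-- Two `x*` and one `a` require `D² = ad_{b₀}` together with `D b₀ = 0`. Three `x*` require
`[x*,b₀] = D b₀ - 2B(b₀,b₀)x = 0`. -/
theorem isLieSuperalgebra_oddExt (hL : IsLieSuperalgebra gr br) (hB : IsEvenNIS gr br B)
    (hD : IsSuperDerivation gr br 1 D) (hinv : IsDInvariant gr B 1 D) (hb : b₀ ∈ gr 0)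
    (hD0 : D b₀ = 0) (hD2 : D ^ 2 = br b₀) (hbb : B b₀ b₀ = 0)
    (h3 : ∀ a ∈ gr 1, B (D a) (br a a) = 0) :
    IsLieSuperalgebra (extGr 1 gr) (oddExtBr gr br B D b₀) where
  isInternal := isInternal_extGr 1 hL.isInternal
  bracket_mem _ _ _ _ hf hg := oddExtBr_mem hL hB hD hb hf hg
  skew i j f g hf hg := by
    rw [mem_extGr] at hf hg
    have e1 := hL.skew i j _ _ hf.2.1 hg.2.1
    have e2 := hinv.form_map_skew hB hD hf.2.1 hg.2.1
    rw [oddExtBr_apply, oddExtBr_apply, parityInv_of_mem hf.2.1, parityInv_of_mem hg.2.1]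
    have z1 : ∀ a ∈ gr 1, B a b₀ = 0 := fun a ha => hB.even 1 0 _ _ ha hb (by decide)
    refine Prod.ext ?_ (Prod.ext ?_ (by simp))
    · simp only [Prod.fst_neg, Prod.smul_fst, smul_eq_mul, e2]
      rcases zmod_two_cases i with rfl | rfl <;> rcases zmod_two_cases j with rfl | rfl
      · have e3 := hB.even 1 0 _ _ (hD.map_mem 0 _ hf.2.1) hg.2.1 (by decide)
        rw [e3, hf.2.2 (by decide), hg.2.2 (by decide)]
        simp
      · rw [hf.2.2 (by decide)]
        simp
        ring
      · rw [hg.2.2 (by decide)]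
        simp
        ring
      · have e3 := hB.even 0 1 _ _ (hD.map_mem 1 _ hf.2.1) hg.2.1 (by decide)
        rw [e3, z1 _ hf.2.1, z1 _ hg.2.1]
        simp
    · simp only [Prod.snd_neg, Prod.fst_neg, Prod.smul_snd, Prod.smul_fst, map_smul]
      rw [e1]
      rcases zmod_two_cases i with rfl | rfl <;> rcases zmod_two_cases j with rfl | rfl
      · rw [hf.2.2 (by decide), hg.2.2 (by decide)]
        simp
      · rw [hf.2.2 (by decide)]
        simp only [ZMod.val_zero, ZMod.val_one]
        module
      · rw [hg.2.2 (by decide)]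
        simp only [ZMod.val_zero, ZMod.val_one]
        module
      · simp only [ZMod.val_one]
        module
  jacobi i j k f g h hf hg hh := by
    have hmem := (mem_extGr.1 (oddExtBr_mem hL hB hD hb hf hg)).2.1
    rw [mem_extGr] at hf hg hh
    obtain ⟨u, a, v⟩ := f
    obtain ⟨u', b, v'⟩ := g
    obtain ⟨u'', c, v''⟩ := h
    dsimp only at hf hg hh
    obtain ⟨-, ha, hv⟩ := hf
    obtain ⟨-, hbj, hv'⟩ := hg
    obtain ⟨-, hc, -⟩ := hh
    have hDa := hD.map_mem i _ ha
    have hDb := hD.map_mem j _ hbj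
    have e1 := hL.jacobi i j k _ _ _ ha hbj hc
    have e2 := hL.skew (i + 1) j _ _ hDa hbj
    have e4 := hL.skew i (j + 1) _ _ ha hDb
    have lab := hD.leibniz i a b ha
    have lac := hD.leibniz i a c ha
    have lbc := hD.leibniz j b c hbj
    have s0 : ∀ y, br y b₀ = -br b₀ y := fun y => by rw [hL.skew_even hb y, neg_neg]
    have c0 := hB.form_comm_even hL hb
    have m0 := hinv.form_map_eq_zero hL hD0
    have fab := hinv.form_map_map hB hD hD2 ha b
    have fac := hinv.form_map_map hB hD hD2 ha c
    have fbc := hinv.form_map_map hB hD hD2 hbj c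
    have fba := hinv.form_map_map hB hD hD2 hbj a
    have sba := hL.skew j i b a hbj ha
    have dd : ∀ y, D (D y) = br b₀ y := fun y => by rw [← hD2, pow_two, Module.End.mul_apply]
    have zab : i ≠ j → B b₀ (br a b) = 0 := fun hij =>
      hB.even 0 (i + j) _ _ hb (hL.bracket_mem i j a b ha hbj)
        (fun h => hij (by rw [← sub_eq_zero, CharTwo.sub_eq_add]; exact h.symm))
    have iab := hB.invariant (D a) b c
    have iba := hB.invariant (D b) a c
    have ca := c0 (br a b)
    have cb := c0 (br a c)
    have cc := c0 (br b c)
    have i0a := hB.invariant b₀ a c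
    have i0b := hB.invariant b₀ b c
    rw [oddExtBr_apply, parityInv_of_mem ha] at hmem
    have hpar := parityInv_of_mem hmem
    have h11 : (1 : ZMod 2) + 1 = 0 := by decide
    dsimp only at hpar
    simp only [oddExtBr_apply, parityInv_of_mem ha, parityInv_of_mem hbj, hpar]
    refine Prod.ext ?_ (Prod.ext ?_ (by simp))
    · simp only [Prod.fst_add, Prod.smul_fst, smul_eq_mul, map_add, map_sub, map_smul,
        LinearMap.add_apply, LinearMap.sub_apply, LinearMap.smul_apply, m0, hbb, hD0, dd,
        map_zero, LinearMap.zero_apply, ca, cb, cc, lab, e4, fab, fac, fbc, fba, sba, map_neg,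
        LinearMap.neg_apply, iab, iba, i0a, i0b]
      rcases zmod_two_cases i with rfl | rfl <;> rcases zmod_two_cases j with rfl | rfl
      · rw [hv (by decide), hv' (by decide)]
        simp
        ring
      · rw [hv (by decide), zab (by decide)]
        simp [ZMod.val_one, h11]
        ring
      · rw [hv' (by decide), zab (by decide)]
        simp [ZMod.val_one]
        ring
      · simp [ZMod.val_one, h11]
        ring
    · simp only [Prod.snd_add, Prod.fst_add, Prod.smul_snd, Prod.smul_fst, map_add, map_sub,
        map_smul, LinearMap.add_apply, LinearMap.sub_apply, LinearMap.smul_apply, hD0, dd, lab, lac,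
        lbc, e2, e1, s0]
      rcases zmod_two_cases i with rfl | rfl <;> rcases zmod_two_cases j with rfl | rfl
      · rw [hv (by decide), hv' (by decide)]
        simp
        module
      · rw [hv (by decide)]
        simp [ZMod.val_one]
        module
      · rw [hv' (by decide)]
        simp [ZMod.val_one, h11]
        module
      · simp [ZMod.val_one, h11]
        module
  odd_triple f hf := by
    rw [mem_extGr] at hf
    obtain ⟨u, a, v⟩ := f
    obtain ⟨-, ha, -⟩ := hf
    dsimp only at ha
    have hDa : D a ∈ gr 0 := hD.map_mem 1 _ ha
    have z1 := hB.even 0 1 _ _ hDa ha (by decide)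
    have z2 := hB.even 1 0 _ _ ha hb (by decide)
    have s0 : br a b₀ = -br b₀ a := by rw [hL.skew_even hb a, neg_neg]
    have s1 := hL.skew_even hDa a
    have l := hD.leibniz 1 a a ha
    have c0 := hB.form_comm_even hL hb
    have m0 := hinv.form_map_eq_zero hL hD0
    have faa := hinv.form_map_map hB hD hD2 ha a
    have ca := c0 (br a a)
    have dd : D (D a) = br b₀ a := by rw [← hD2, pow_two, Module.End.mul_apply]
    have hm := parityInv_of_mem ha
    simp only [ZMod.val_one, pow_one, mul_one, neg_smul, one_smul] at l faa hm
    simp only [oddExtBr_apply, hm, z1, z2]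
    refine Prod.ext ?_ (Prod.ext ?_ rfl)
    -- The term of the `x`-coordinate without `x*` is `-B(D a, [a,a])`, zero by `h3`.
    · simp only [map_add, map_sub, map_smul, map_neg, LinearMap.add_apply, LinearMap.sub_apply,
        LinearMap.smul_apply, LinearMap.neg_apply, h3 a ha, m0, faa, ca, hbb, smul_eq_mul,
        Prod.fst_zero]
      ring
    · simp only [map_add, map_sub, map_smul, map_neg, hL.odd_triple a ha, l, s0, s1, dd, hD0,
        Prod.snd_zero, Prod.fst_zero]
      module

theorem isEvenNIS_oddExt (hL : IsLieSuperalgebra gr br) (hB : IsEvenNIS gr br B)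
    (hD : IsSuperDerivation gr br 1 D) (hinv : IsDInvariant gr B 1 D) (hb : b₀ ∈ gr 0) :
    IsEvenNIS (extGr 1 gr) (oddExtBr gr br B D b₀) (extForm 1 B) where
  even i j _ _ hf hg hij := extForm_even hB 1 i j hf hg hij
  symm i j _ _ hf hg := extForm_symm hB 1 i j hf hg
  invariant f g h := by
    -- The involution absorbs the sign `(-1)^{p(a)}` of `D`-invariance, so that `e1` and `e2` hold
    -- for inhomogeneous elements too.
    have e1 : ∀ a c, B (D (parityInv gr a)) c = -B a (D c) := by
      intro a c
      obtain ⟨a₀, h₀, a₁, h₁, rfl⟩ := hL.exists_even_add_odd a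
      have i0 := hinv 0 a₀ c h₀
      have i1 := hinv 1 a₁ c h₁
      simp [ZMod.val_one] at i0 i1
      simp only [map_add, parityInv_of_mem h₀, parityInv_of_mem h₁, ZMod.val_zero, ZMod.val_one,
        pow_zero, pow_one, map_smul, LinearMap.add_apply, LinearMap.smul_apply, smul_eq_mul]
      linear_combination i0 - i1
    have e2 : ∀ a b, B a (D (parityInv gr b)) = B (D a) b := by
      intro a b
      obtain ⟨a₀, h₀, a₁, h₁, rfl⟩ := hL.exists_even_add_odd a
      obtain ⟨b₀, k₀, b₁, k₁, rfl⟩ := hL.exists_even_add_odd b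
      have i01 := hinv 0 a₀ b₁ h₀
      have i10 := hinv 1 a₁ b₀ h₁
      have z1 := hB.even 0 1 _ _ h₀ (hD.map_mem 0 _ k₀) (by decide)
      have z2 := hB.even 1 0 _ _ h₁ (hD.map_mem 1 _ k₁) (by decide)
      have z3 := hB.even 1 0 _ _ (hD.map_mem 0 _ h₀) k₀ (by decide)
      have z4 := hB.even 0 1 _ _ (hD.map_mem 1 _ h₁) k₁ (by decide)
      simp [ZMod.val_one] at i01 i10
      simp only [map_add, parityInv_of_mem k₀, parityInv_of_mem k₁, ZMod.val_zero, ZMod.val_one,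
        pow_zero, pow_one, map_smul, LinearMap.add_apply, smul_eq_mul, z1, z2, z3, z4]
      linear_combination -i01 - i10
    have e3 := hB.form_comm_even hL hb h.2.1
    simp only [oddExtBr_apply, extForm_apply, map_add, map_sub, map_smul, LinearMap.add_apply,
      LinearMap.sub_apply, LinearMap.smul_apply, smul_eq_mul, hB.invariant, e1, e2, ← e3,
      ZMod.val_one, pow_one]
    ring
  nondegenerate := extForm_nondegenerate hB.nondegenerate 1

/-! ### Odd `D`: the `p|2p`-structure -/

lemma oddExtBr_apply_even {a : A} (ha : a ∈ gr 0) (w v : K) (c : A) :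
    oddExtBr gr br B D b₀ (0, a, 0) (w, c, v) =
      (-B (D a) c + 2 * v * B a b₀, br a c - v • D a, 0) := by
  rw [oddExtBr_apply, parityInv_of_mem ha]
  simp

lemma oddExtBr_pow_succ {a : A} (ha : a ∈ gr 0) (w : K) (c : A) (n : ℕ) :
    ((oddExtBr gr br B D b₀ (0, a, 0) : Module.End K (DExt K A)) ^ (n + 1)) (w, c, 0) =
      (-B (D a) (((br a : Module.End K A) ^ n) c), ((br a : Module.End K A) ^ (n + 1)) c, 0) := by
  induction n with
  | zero => simp [oddExtBr_apply_even ha]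
  | succ n ih =>
    rw [pow_succ' _ (n + 1), Module.End.mul_apply, ih, oddExtBr_apply_even ha]
    simp [pow_succ']

/-- On `x*` the two `x`-coordinates are `2B(a^[p], b₀)` and `B(D a, (ad_a)^{p-2}(D a))`, so `hS` is
exactly the needed equality. The other components follow from restrictedness and the
self-adjointness of `(ad_a)^{p-1}`. -/
lemma oddExtBr_pMap {p : ℕ} [hp : Fact p.Prime] (hodd : Odd p)
    (hL : IsLieSuperalgebra gr br) (hB : IsEvenNIS gr br B) (S : P2pStructure p gr br)
    (hres : IsRestrictedDer S D)
    (hS : ∀ a : gr 0, 2 * B (S.pMap a : A) b₀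
        - B (D (a : A)) (((br (a : A) : Module.End K A) ^ (p - 2)) (D (a : A))) = 0) (a : gr 0) :
    (oddExtBr gr br B D b₀ (0, (S.pMap a : A), 0) : Module.End K (DExt K A)) =
      (oddExtBr gr br B D b₀ (0, (a : A), 0) : Module.End K (DExt K A)) ^ p := by
  have hp2 := hp.out.two_le
  obtain ⟨n, rfl⟩ : ∃ n, p = n + 2 := ⟨p - 2, by omega⟩
  have hn : Odd n := by
    rw [Nat.odd_add] at hodd
    exact hodd.2 (by decide)
  have hr : D (S.pMap a : A) = ((br (a : A) : Module.End K A) ^ (n + 1)) (D (a : A)) := hres a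
  have hS' := hS a
  rw [Nat.add_sub_cancel, sub_eq_zero] at hS'
  refine LinearMap.ext fun f => ?_
  obtain ⟨y, c, v⟩ := f
  have hsplit : ((y, c, v) : DExt K A) = (y, c, 0) + v • (0, 0, 1) := by simp
  have h1 : ((oddExtBr gr br B D b₀ (0, (a : A), 0) : Module.End K (DExt K A)) ^ (n + 2))
      (0, 0, 1) = (2 * B (S.pMap a : A) b₀,
        -((br (a : A) : Module.End K A) ^ (n + 1)) (D (a : A)), 0) := by
    rw [pow_succ, Module.End.mul_apply]
    have : (oddExtBr gr br B D b₀ (0, (a : A), 0)) (0, 0, 1) = (2 * B a b₀, -D (a : A), 0) := by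
      simp [oddExtBr_apply_even a.2]
    rw [this, oddExtBr_pow_succ a.2, map_neg, map_neg, map_neg, neg_neg, hS']
  rw [hsplit, map_add, map_add, map_smul, map_smul, h1, oddExtBr_pow_succ a.2,
    oddExtBr_apply_even (S.pMap a).2, oddExtBr_apply_even (S.pMap a).2, S.ad_pMap, hr,
    form_ad_pow hL hB a.2, hn.add_one.neg_one_pow, one_mul]
  simp

/-- For even `a`, `b` the element `D a` is odd, so `B(D a, b) = 0` and `𝔞_0` is embedded in `𝔤` as a
Lie subalgebra. -/
lemma sSum_oddExtBr {p : ℕ} (hL : IsLieSuperalgebra gr br) (h2 : (2 : K) ≠ 0)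
    (hB : IsEvenNIS gr br B) (hD : IsSuperDerivation gr br 1 D) (a b : gr 0) :
    sSum p (oddExtBr gr br B D b₀) (0, (a : A), 0) (0, (b : A), 0) =
      (0, sSum p br (a : A) (b : A), 0) := by
  let _ := hL.evenLieRing h2
  let _ := hL.evenLieAlgebra h2
  have e1 := map_sSum (br := lieBr K (gr 0)) (br' := br) (gr 0).subtype (fun x y => rfl) p a b
  have e2 := map_sSum (br := lieBr K (gr 0)) (br' := oddExtBr gr br B D b₀)
    (LinearMap.inr K K (A × K) ∘ₗ LinearMap.inl K A K ∘ₗ (gr 0).subtype) (fun x y => by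
      have hz := hB.even 1 0 _ _ (hD.map_mem 0 _ x.2) y.2 (by decide)
      change ((0, br (x : A) y, 0) : DExt K A) =
        oddExtBr gr br B D b₀ (0, (x : A), 0) (0, (y : A), 0)
      rw [oddExtBr_apply_even x.2, hz]
      simp) p a b
  exact e2.symm.trans (by simp only [LinearMap.comp_apply, e1]; rfl)

theorem existsUnique_P2p_oddExt {p : ℕ} [hp : Fact p.Prime] (hodd : Odd p)
    (hL : IsLieSuperalgebra gr br) (hB : IsEvenNIS gr br B) (h2 : (2 : K) ≠ 0)
    (hLG : IsLieSuperalgebra (extGr 1 gr) (oddExtBr gr br B D b₀))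
    (S : P2pStructure p gr br) (hres : IsRestrictedDer S D) (hD : IsSuperDerivation gr br 1 D)
    (hS : ∀ a : gr 0, 2 * B (S.pMap a : A) b₀
        - B (D (a : A)) (((br (a : A) : Module.End K A) ^ (p - 2)) (D (a : A))) = 0) :
    ∃! T : P2pStructure p (extGr 1 gr) (oddExtBr gr br B D b₀),
      ∀ a : gr 0, T.pMap (inclEven 1 gr a) = inclEven 1 gr (S.pMap a) := by
  refine ⟨hLG.mkP2p (fun X => inclEven 1 gr (S.pMap ⟨(X : DExt K A).2.1, (mem_extGr.1 X.2).2.1⟩))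
    h2 ?_ ?_ ?_, fun a => rfl, fun T hT => hLG.P2p_ext h2 fun X => ?_⟩
  · intro X
    rw [eq_inclEven X]
    exact oddExtBr_pMap hodd hL hB S hres hS _
  · intro c X
    have := S.pMap_smul c ⟨(X : DExt K A).2.1, (mem_extGr.1 X.2).2.1⟩
    refine Subtype.ext (Prod.ext (by simp) (Prod.ext ?_ (by simp)))
    exact congrArg Subtype.val this
  · intro X Y
    have e := sSum_oddExtBr (p := p) (b₀ := b₀) hL h2 hB hD
      ⟨(X : DExt K A).2.1, (mem_extGr.1 X.2).2.1⟩ ⟨(Y : DExt K A).2.1, (mem_extGr.1 Y.2).2.1⟩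
    have hX := congrArg Subtype.val (eq_inclEven X)
    have hY := congrArg Subtype.val (eq_inclEven Y)
    rw [coe_inclEven] at hX hY
    rw [← hX, ← hY] at e
    rw [e]
    refine Prod.ext (by simp) (Prod.ext ?_ (by simp))
    refine (S.pMap_add_sSum ⟨(X : DExt K A).2.1, (mem_extGr.1 X.2).2.1⟩
      ⟨(Y : DExt K A).2.1, (mem_extGr.1 Y.2).2.1⟩).trans ?_
    simp
  · rw [eq_inclEven X, hT]
    rfl

end OddExt

end SuperDE

/-! ### Assembly of both cases -/

theorem mainTheorem3 {K : Type*} [Field K] {p : ℕ} [Fact p.Prime] [CharP K p] (hp : 2 < p)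
    {A : Type*} [AddCommGroup A] [Module K A]
    (gr : ZMod 2 → Submodule K A) [DirectSum.Decomposition gr]
    (br : A →ₗ[K] A →ₗ[K] A) (hL : SuperDE.IsLieSuperalgebra gr br)
    (B : A →ₗ[K] A →ₗ[K] K) (hB : SuperDE.IsEvenNIS gr br B)
    (S : SuperDE.P2pStructure p gr br)
    (D : Module.End K A) (hres : SuperDE.IsRestrictedDer S D) :
    -- (i) odd derivations
    (SuperDE.IsSuperDerivation gr br 1 D → SuperDE.IsDInvariant gr B 1 D →
      ∀ b₀ ∈ gr 0, D b₀ = 0 → D ^ 2 = br b₀ → B b₀ b₀ = 0 →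
      (p = 3 → ∀ a ∈ gr 1, B (D a) (br a a) = 0) →
      (∀ a : gr 0, 2 * B (S.pMap a : A) b₀
        - B (D (a : A)) (((br (a : A) : Module.End K A) ^ (p - 2)) (D (a : A))) = 0) →
      SuperDE.IsLieSuperalgebra (SuperDE.extGr 1 gr) (SuperDE.oddExtBr gr br B D b₀) ∧
      SuperDE.IsEvenNIS (SuperDE.extGr 1 gr) (SuperDE.oddExtBr gr br B D b₀)
        (SuperDE.extForm 1 B) ∧
      ∃! T : SuperDE.P2pStructure p (SuperDE.extGr 1 gr) (SuperDE.oddExtBr gr br B D b₀),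
        ∀ a : gr 0, T.pMap (SuperDE.inclEven 1 gr a) = SuperDE.inclEven 1 gr (S.pMap a)) ∧
    -- (ii) even derivations
    (SuperDE.IsSuperDerivation gr br 0 D → SuperDE.IsDInvariant gr B 0 D →
      ∀ (γ : K) (a₀ : gr 0), D ^ p = γ • D + br (a₀ : A) → D (a₀ : A) = 0 →
      ∀ (m l : K) (c₀ : gr 0), (∀ a : A, br (c₀ : A) a = 0) → D (c₀ : A) = 0 →
      ∀ P : gr 0 → K, (∀ (c : K) (a : gr 0), P (c • a) = c ^ p * P a) →
      (∀ a b : gr 0, P (a + b) - P a - P b =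
        ∑ i ∈ Finset.Icc 1 (p - 1), SuperDE.sigmaCoeff p br B D (a : A) (b : A) i) →
      SuperDE.IsLieSuperalgebra (SuperDE.extGr 0 gr) (SuperDE.evenExtBr br B D) ∧
      SuperDE.IsEvenNIS (SuperDE.extGr 0 gr) (SuperDE.evenExtBr br B D)
        (SuperDE.extForm 0 B) ∧
      ∃! T : SuperDE.P2pStructure p (SuperDE.extGr 0 gr) (SuperDE.evenExtBr br B D),
        (∀ a : gr 0, T.pMap (SuperDE.inclEven 0 gr a) =
          SuperDE.inclEven 0 gr (S.pMap a) + P a • SuperDE.xEven gr) ∧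
        T.pMap (SuperDE.xStarEven gr) =
          SuperDE.inclEven 0 gr a₀ + l • SuperDE.xEven gr + γ • SuperDE.xStarEven gr ∧
        T.pMap (SuperDE.xEven gr) = m • SuperDE.xEven gr + SuperDE.inclEven 0 gr c₀) := by
  have hodd : Odd p := (Fact.out : p.Prime).odd_of_ne_two (by omega)
  have h2 : (2 : K) ≠ 0 := by
    intro h
    have h' : ((2 : ℕ) : K) = 0 := by exact_mod_cast h
    exact Nat.not_dvd_of_pos_of_lt (by omega) hp ((CharP.cast_eq_zero_iff K p 2).1 h')
  refine ⟨fun hD hinv b₀ hb hD0 hD2 hbb h3 hS => ?_,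
    fun hD hinv γ a₀ hDp ha₀ m l c₀ hc hDc P hPs hPa =>
      ⟨SuperDE.isLieSuperalgebra_evenExt hL hB hD hinv, SuperDE.isEvenNIS_evenExt hL hB hinv,
        SuperDE.existsUnique_P2p_evenExt hodd hL hB h2 S hres hD hinv γ a₀ hDp ha₀ m l c₀ hc hDc
          P hPs hPa⟩⟩
  have h3' : ∀ a ∈ gr 1, B (D a) (br a a) = 0 := by
    -- For `p ≠ 3` the number `3` is invertible and the condition on `[a,a]` is automatic.
    by_cases h : p = 3
    · exact h3 h
    · have h3K : (3 : K) ≠ 0 := by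
        intro h0
        have h0' : ((3 : ℕ) : K) = 0 := by exact_mod_cast h0
        have hd := (CharP.cast_eq_zero_iff K p 3).1 h0'
        exact h ((Nat.prime_dvd_prime_iff_eq Fact.out Nat.prime_three).1 hd)
      exact fun a ha => SuperDE.form_map_bracket_self hL hB hD hinv h3K ha
  have hLG := SuperDE.isLieSuperalgebra_oddExt hL hB hD hinv hb hD0 hD2 hbb h3'
  exact ⟨hLG, SuperDE.isEvenNIS_oddExt hL hB hD hinv hb,
    SuperDE.existsUnique_P2p_oddExt hodd hL hB h2 hLG S hres hD hS⟩
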